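/- All Lie algebras are real and finite-dimensional. Let $\mathfrak l$ be a nilpotent Lie algebra with lower central series $\mathfrak l^1=\mathfrak l$, $\mathfrak l^{k+1}=[\mathfrak l,\mathfrak l^{k}]$, and put $\mathfrak l'=\mathfrak l^2$. A semi-simple orthogonal $\mathfrak l$-module $(\rho,\mathfrak a)$ is a finite-dimensional real vector space $\mathfrak a$ with a non-degenerate symmetric bilinear form $\langle\cdot,\cdot\rangle$ and a semi-simple representation $\rho$ of $\mathfrak l$ on $\mathfrak a$ by skew-symmetric operators. A quadratic 2-cocycle is a pair $(\alpha,\gamma)$ of an alternating 2-form $\alpha$ on $\mathfrak l$ with values in $\mathfrak a$ and an alternating real 3-form $\gamma$ on $\mathfrak l$ with $d\alpha=0$ and $d\gamma=\frac12\langle\alpha\wedge\alpha\rangle$ ($d$ is the Chevalley–Eilenberg differential). The pairs $(\tau,\sigma)$ of a linear map $\tau:\mathfrak l\to\mathfrak a$ and an alternating real 2-form $\sigma$ on $\mathfrak l$ act on them by $(\alpha,\gamma)(\tau,\sigma)=(\alpha+d\tau,\ \gamma+d\sigma+\langle(\alpha+\frac12 d\tau)\wedge\tau\rangle)$; the set of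 orbits is $\mathcal H^2_Q(\mathfrak l,\mathfrak a)$. Let $m\ge 0$ be such that $\mathfrak l^{m+2}=0$, and put $\mathfrak l_{(0)}=\mathfrak z(\mathfrak l)\cap\ker\rho$, $\mathfrak l_{(k)}=\mathfrak z(\mathfrak l)\cap\mathfrak l^{k+1}$ for $k\ge1$. A class in $\mathcal H^2_Q(\mathfrak l,\mathfrak a)$, represented by $(\alpha,\gamma)$ with $\alpha(\mathfrak l,\mathfrak l)\subset\mathfrak a^{\mathfrak l}$, is admissible if for all $0\le k\le m$: $(A_k)$ if $L_0\in\mathfrak l_{(k)}$ and there are $A_0\in\mathfrak a$ and $Z_0\in(\mathfrak l^{k+1})^*$ such that for all $L\in\mathfrak l$ one has $\alpha(L,L_0)=0$ and $\gamma(L,L_0,\cdot)=-\langle A_0,\alpha(L,\cdot)\rangle+\langle Z_0,[L,\cdot]\rangle$ on $\mathfrak l^{k+1}$, then $L_0=0$; $(B_k)$ the image under $\alpha$ of the kernel of the bracket map $\mathfrak l\otimes\mathfrak l^{k+1}\to\mathfrak l$ is a non-degenerate subspace of $\mathfrak a$. The nilpotent Lie algebra $\mathfrak l$ is called admissible if some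 semi-simple orthogonal $\mathfrak l$-module $\mathfrak a$ has an admissible class in $\mathcal H^2_Q(\mathfrak l,\mathfrak a)$. Define nilpotent Lie algebras by the non-zero brackets of basis vectors (up to skew-symmetry): $\mathfrak h(1)=\{[X_1,X_2]=Y\}$, $\mathfrak g_{4,1}=\{[X_1,Z]=Y,\ [X_1,X_2]=Z\}$, $\mathfrak g_{5,2}=\{[X_1,X_2]=Y,\ [X_1,X_3]=Z\}$, $\mathfrak g_{6,4}=\{[X_1,X_2]=Y,\ [X_1,X_3]=Z,\ [X_3,X_4]=Y\}$, $\mathfrak g_{6,5}=\{[X_1,X_2]=Y,\ [X_1,X_3]=Z,\ [X_2,X_4]=Z,\ [X_3,X_4]=-Y\}$, where the basis consists of the vectors that occur; $\mathbb R^k$ denotes the abelian Lie algebra of dimension $k\ge 0$. **Proposition.** If $\mathfrak l$ is an admissible nilpotent Lie algebra with $\dim\mathfrak l'=2$, then for some $k\ge0$ it is isomorphic to one of $$\mathfrak h(1)\oplus\mathfrak h(1)\oplus\mathbb R^k,\quad \mathfrak g_{4,1}\oplus\mathbb R^k,\quad \mathfrak g_{5,2}\oplus\mathbb R^k,\quad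 \mathfrak g_{6,4}\oplus\mathbb R^k,\quad \mathfrak g_{6,5}\oplus\mathbb R^k.$$ Moreover, for every $k\ge0$ all five of these Lie algebras are admissible. -/

import Mathlib

open scoped TensorProduct
open LieModule.Cohomology

namespace QuadLie

section Cohomology

variable (L : Type*) [LieRing L] [LieAlgebra ℝ L]
  (A : Type*) [AddCommGroup A] [Module ℝ A] [LieRingModule L A] [LieModule ℝ L A]

/-- `(A, B)` is a semi-simple orthogonal `L`-module: `A` is a finite-dimensional representation of
`L`, `B` is a (possibly indefinite) inner product on `A` for which `L` acts by skew-symmetric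
operators, and every submodule of `A` has an invariant complement. -/
structure IsSemisimpleOrthogonalModule (B : LinearMap.BilinForm ℝ A) : Prop where
  finiteDimensional : FiniteDimensional ℝ A
  symm : B.IsSymm
  nondegenerate : B.Nondegenerate
  skew : ∀ (x : L) (a b : A), B ⁅x, a⁆ b + B a ⁅x, b⁆ = 0
  semisimple : ComplementedLattice (LieSubmodule ℝ L A)

variable {L A}

/-- The product `⟨τ ∧ τ'⟩` of two `A`-valued 1-cochains, a real-valued 2-cochain. -/
def wedge₁₁ (B : LinearMap.BilinForm ℝ A) (τ τ' : oneCochain ℝ L A) : twoCochain ℝ L ℝ :=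
  ⟨B.compl₁₂ τ τ' - (B.compl₁₂ τ τ').flip, fun x => by simp⟩

/-- The product `⟨α ∧ τ⟩` of an `A`-valued 2-cochain and an `A`-valued 1-cochain. -/
def wedge₂₁ (B : LinearMap.BilinForm ℝ A) (α : twoCochain ℝ L A) (τ : oneCochain ℝ L A)
    (x y z : L) : ℝ :=
  B (α x y) (τ z) - B (α x z) (τ y) + B (α y z) (τ x)

/-- The product `⟨α ∧ β⟩` of two `A`-valued 2-cochains. -/
def wedge₂₂ (B : LinearMap.BilinForm ℝ A) (α β : twoCochain ℝ L A) (w x y z : L) : ℝ :=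
  B (α w x) (β y z) - B (α w y) (β x z) + B (α w z) (β x y)
    + B (α x y) (β w z) - B (α x z) (β w y) + B (α y z) (β w x)

/-- The coboundary of a real-valued 2-cochain (trivial coefficients). -/
def dTwo (σ : twoCochain ℝ L ℝ) (x y z : L) : ℝ :=
  -σ ⁅x, y⁆ z + σ ⁅x, z⁆ y - σ ⁅y, z⁆ x

/-- The coboundary of a real-valued 3-cochain (trivial coefficients). -/
def dThree (γ : L [⋀^Fin 3]→ₗ[ℝ] ℝ) (w x y z : L) : ℝ :=
  -γ ![⁅w, x⁆, y, z] + γ ![⁅w, y⁆, x, z] - γ ![⁅w, z⁆, x, y]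
    - γ ![⁅x, y⁆, w, z] + γ ![⁅x, z⁆, w, y] - γ ![⁅y, z⁆, w, x]

variable (L) in
/-- Quadratic 2-cocycles: pairs `(α, γ)` of a 2-cochain with values in `A` and a real-valued
3-cochain such that `dα = 0` and `dγ = ½ ⟨α ∧ α⟩`. -/
structure QuadCocycle (B : LinearMap.BilinForm ℝ A) where
  α : twoCochain ℝ L A
  γ : L [⋀^Fin 3]→ₗ[ℝ] ℝ
  d_α : d₂₃ ℝ L A α = 0
  d_γ : ∀ w x y z : L, dThree γ w x y z = (1 / 2 : ℝ) * wedge₂₂ B α α w x y z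

/-- Two quadratic cocycles are equivalent if they lie in the same orbit of the group of quadratic
1-cochains `(τ, σ)`, which acts by
`(α, γ)(τ, σ) = (α + dτ, γ + dσ + ⟨(α + ½ dτ) ∧ τ⟩)`. -/
def QuadCocycle.Equiv (B : LinearMap.BilinForm ℝ A) (c c' : QuadCocycle L B) : Prop :=
  ∃ (τ : oneCochain ℝ L A) (σ : twoCochain ℝ L ℝ),
    c'.α = c.α + d₁₂ ℝ L A τ ∧
    ∀ x y z : L, c'.γ ![x, y, z] = c.γ ![x, y, z] + dTwo σ x y z
      + wedge₂₁ B (c.α + (1 / 2 : ℝ) • d₁₂ ℝ L A τ) τ x y z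

variable {B : LinearMap.BilinForm ℝ A}

theorem QuadCocycle.Equiv.refl (c : QuadCocycle L B) : c.Equiv B c :=
  ⟨0, 0, by simp, fun x y z => by
    have h : ∀ x y : L, (0 : twoCochain ℝ L ℝ) x y = 0 := fun _ _ => rfl
    simp [dTwo, wedge₂₁, h]⟩

theorem QuadCocycle.Equiv.symm {c c' : QuadCocycle L B} (h : c.Equiv B c') : c'.Equiv B c := by
  obtain ⟨τ, σ, h₁, h₂⟩ := h
  have h₀ : ∀ x y : L, d₁₂ ℝ L A (-τ) x y = (-1 : ℝ) • d₁₂ ℝ L A τ x y := fun x y => by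
    simp only [d₁₂_apply_apply, LinearMap.neg_apply, lie_neg]; module
  have h₁' : c.α = c'.α + d₁₂ ℝ L A (-τ) := by
    rw [h₁]
    ext x y
    change c.α x y = (c.α x y + d₁₂ ℝ L A τ x y) + d₁₂ ℝ L A (-τ) x y
    rw [h₀]; module
  refine ⟨-τ, (-1 : ℝ) • σ, h₁', fun x y z => ?_⟩
  have h₃ : c'.α + (1 / 2 : ℝ) • d₁₂ ℝ L A (-τ) = c.α + (1 / 2 : ℝ) • d₁₂ ℝ L A τ := by
    rw [h₁]
    ext x y
    change (c.α x y + d₁₂ ℝ L A τ x y) + (1 / 2 : ℝ) • d₁₂ ℝ L A (-τ) x y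
      = c.α x y + (1 / 2 : ℝ) • d₁₂ ℝ L A τ x y
    rw [h₀]; module
  rw [h₂, h₃]
  simp only [dTwo, wedge₂₁, smul_apply_apply, LinearMap.neg_apply, map_neg, smul_eq_mul]
  ring

theorem QuadCocycle.Equiv.trans (hB : IsSemisimpleOrthogonalModule L A B)
    {c c' c'' : QuadCocycle L B} (h : c.Equiv B c') (h' : c'.Equiv B c'') : c.Equiv B c'' := by
  obtain ⟨τ, σ, h₁, h₂⟩ := h
  obtain ⟨τ', σ', h₁', h₂'⟩ := h'
  refine ⟨τ + τ', σ + σ' + (1 / 2 : ℝ) • wedge₁₁ B τ τ', by rw [h₁', h₁, map_add]; abel,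
    fun x y z => ?_⟩
  have hs : ∀ a b : A, B a b = B b a := hB.symm.eq
  have hk : ∀ (x : L) (a b : A), B a ⁅x, b⁆ = -B b ⁅x, a⁆ := fun x a b => by
    have := hB.skew x a b
    rw [hs ⁅x, a⁆ b] at this
    linarith
  have hw : ∀ x y : L, wedge₁₁ B τ τ' x y = B (τ x) (τ' y) - B (τ y) (τ' x) := fun x y => rfl
  rw [h₂', h₂, h₁]
  simp only [dTwo, wedge₂₁, add_apply_apply, smul_apply_apply, hw, map_add, map_smul,
    LinearMap.add_apply, LinearMap.smul_apply, smul_eq_mul, d₁₂_apply_apply, map_sub,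
    LinearMap.sub_apply]
  have e : ∀ (x : L) (a b : A), B ⁅x, a⁆ b = B b ⁅x, a⁆ := fun x a b => hs _ _
  simp only [e, hs (τ' ⁅x, y⁆), hs (τ' ⁅x, z⁆), hs (τ' ⁅y, z⁆), hs (τ ⁅x, y⁆) (τ' _),
    hs (τ ⁅x, z⁆) (τ' _), hs (τ ⁅y, z⁆) (τ' _), hk _ (τ' _) (τ _)]
  ring

/-- The equivalence relation of quadratic cocycles for an orthogonal module. -/
def quadSetoid (hB : IsSemisimpleOrthogonalModule L A B) : Setoid (QuadCocycle L B) where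
  r := QuadCocycle.Equiv B
  iseqv := ⟨QuadCocycle.Equiv.refl, QuadCocycle.Equiv.symm, QuadCocycle.Equiv.trans hB⟩

/-- The second quadratic cohomology set of `L` with coefficients in `(A, B)`. -/
def QuadCohomology (hB : IsSemisimpleOrthogonalModule L A B) : Type _ :=
  Quotient (quadSetoid hB)

/-! In Mathlib's indexing `lowerCentralSeries ℝ L L k` is the term `l^{k+1}` of the lower central
series `l^1 = l`, `l^{k+1} = [l, l^k]`. -/

variable (L A) in
/-- The ideals `l_(0) = z(l) ∩ ker ρ` and `l_(k) = z(l) ∩ l^{k+1}` for `k ≥ 1`. -/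
def centralPart : ℕ → LieIdeal ℝ L
  | 0 => LieAlgebra.center ℝ L ⊓ LieModule.ker ℝ L A
  | k + 1 => LieAlgebra.center ℝ L ⊓ LieModule.lowerCentralSeries ℝ L L (k + 1)

variable (L) in
/-- The bracket as a linear map `l ⊗ l^{k+1} → l`. -/
def bracketMap (k : ℕ) : L ⊗[ℝ] LieModule.lowerCentralSeries ℝ L L k →ₗ[ℝ] L :=
  TensorProduct.lift ((LieModule.toEnd ℝ L L : L →ₗ[ℝ] L →ₗ[ℝ] L).compl₂
    (LieModule.lowerCentralSeries ℝ L L k).toSubmodule.subtype)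

/-- A 2-cochain as a linear map `l ⊗ l^{k+1} → A`. -/
def cochainMap (α : twoCochain ℝ L A) (k : ℕ) :
    L ⊗[ℝ] LieModule.lowerCentralSeries ℝ L L k →ₗ[ℝ] A :=
  TensorProduct.lift ((α : L →ₗ[ℝ] L →ₗ[ℝ] A).compl₂
    (LieModule.lowerCentralSeries ℝ L L k).toSubmodule.subtype)

/-- Condition `(A_k)`. -/
def ConditionA (c : QuadCocycle L B) (k : ℕ) : Prop :=
  ∀ L₀ ∈ centralPart L A k,
    (∃ (A₀ : A) (Z₀ : Module.Dual ℝ (LieModule.lowerCentralSeries ℝ L L k)),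
      ∀ x : L, c.α x L₀ = 0 ∧
        ∀ y : LieModule.lowerCentralSeries ℝ L L k,
          c.γ ![x, L₀, (y : L)] = -B A₀ (c.α x (y : L)) + Z₀ ⁅x, y⁆) →
    L₀ = 0

/-- Condition `(B_k)`: the image under `α` of the kernel of `l ⊗ l^{k+1} → l` is a non-degenerate
subspace. -/
def ConditionB (c : QuadCocycle L B) (k : ℕ) : Prop :=
  (B.restrict ((LinearMap.ker (bracketMap L k)).map (cochainMap c.α k))).Nondegenerate

/-- Admissibility of a quadratic cohomology class of a nilpotent Lie algebra. It is tested on a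
representative `(α, γ)` for which `α` has values in the invariants of `A`, for all `0 ≤ k ≤ m`,
where `l^{m+2} = 0`. -/
def QuadCohomology.IsAdmissible (hB : IsSemisimpleOrthogonalModule L A B)
    (φ : QuadCohomology hB) : Prop :=
  ∃ c : QuadCocycle L B, Quotient.mk (quadSetoid hB) c = φ ∧
    (∀ x y : L, c.α x y ∈ LieModule.maxTrivSubmodule ℝ L A) ∧
    ∃ m : ℕ, LieModule.lowerCentralSeries ℝ L L (m + 1) = ⊥ ∧
      ∀ k ≤ m, ConditionA c k ∧ ConditionB c k

variable (L) in
/-- A nilpotent Lie algebra is admissible if there is a semi-simple orthogonal module for which an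
admissible quadratic cohomology class exists. (Non-nilpotent Lie algebras never satisfy this.) -/
def IsAdmissible : Prop :=
  ∃ (A : Type) (_ : AddCommGroup A) (_ : Module ℝ A) (_ : LieRingModule L A)
    (_ : LieModule ℝ L A) (B : LinearMap.BilinForm ℝ A)
    (hB : IsSemisimpleOrthogonalModule L A B) (φ : QuadCohomology hB), φ.IsAdmissible hB

end Cohomology

/-! ### The Lie algebras of the classification

Each of them is a coordinate space with the bracket written in coordinates with respect to the
named basis; all brackets of basis vectors that are not listed vanish. -/

/-- The Lie algebra `h(1)`, with basis `X₁, X₂, Y` and `[X₁, X₂] = Y`. -/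
def H1 : Type := Fin 3 → ℝ

instance : AddCommGroup H1 := inferInstanceAs (AddCommGroup (Fin 3 → ℝ))
instance : Module ℝ H1 := inferInstanceAs (Module ℝ (Fin 3 → ℝ))

/-- The Lie algebra `g_{4,1}`, with basis `X₁, X₂, Y, Z` and `[X₁, Z] = Y`, `[X₁, X₂] = Z`. -/
def G41 : Type := Fin 4 → ℝ

instance : AddCommGroup G41 := inferInstanceAs (AddCommGroup (Fin 4 → ℝ))
instance : Module ℝ G41 := inferInstanceAs (Module ℝ (Fin 4 → ℝ))

/-- The Lie algebra `g_{5,2}`, with basis `X₁, X₂, X₃, Y, Z` and `[X₁, X₂] = Y`,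
`[X₁, X₃] = Z`. -/
def G52 : Type := Fin 5 → ℝ

instance : AddCommGroup G52 := inferInstanceAs (AddCommGroup (Fin 5 → ℝ))
instance : Module ℝ G52 := inferInstanceAs (Module ℝ (Fin 5 → ℝ))

/-- The Lie algebra `g_{6,4}`, with basis `X₁, X₂, X₃, X₄, Y, Z` and `[X₁, X₂] = Y`,
`[X₁, X₃] = Z`, `[X₃, X₄] = Y`. -/
def G64 : Type := Fin 6 → ℝ

instance : AddCommGroup G64 := inferInstanceAs (AddCommGroup (Fin 6 → ℝ))
instance : Module ℝ G64 := inferInstanceAs (Module ℝ (Fin 6 → ℝ))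

/-- The Lie algebra `g_{6,5}`, with basis `X₁, X₂, X₃, X₄, Y, Z` and `[X₁, X₂] = Y`,
`[X₁, X₃] = Z`, `[X₂, X₄] = Z`, `[X₃, X₄] = -Y`. -/
def G65 : Type := Fin 6 → ℝ

instance : AddCommGroup G65 := inferInstanceAs (AddCommGroup (Fin 6 → ℝ))
instance : Module ℝ G65 := inferInstanceAs (Module ℝ (Fin 6 → ℝ))

/-- The abelian Lie algebra `ℝ^k`. -/
def Rab (k : ℕ) : Type := Fin k → ℝ

instance (k : ℕ) : AddCommGroup (Rab k) := inferInstanceAs (AddCommGroup (Fin k → ℝ))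
instance (k : ℕ) : Module ℝ (Rab k) := inferInstanceAs (Module ℝ (Fin k → ℝ))

/-- The `(i, j)` minor of two coordinate vectors. -/
def minor {n : ℕ} (i j : Fin n) (x y : Fin n → ℝ) : ℝ := x i * y j - x j * y i

/-- The bracket of `h(1)` in coordinates. -/
def H1.br (x y : Fin 3 → ℝ) : Fin 3 → ℝ := ![0, 0, minor 0 1 x y]

/-- The bracket of `g_{4,1}` in coordinates. -/
def G41.br (x y : Fin 4 → ℝ) : Fin 4 → ℝ := ![0, 0, minor 0 3 x y, minor 0 1 x y]

/-- The bracket of `g_{5,2}` in coordinates. -/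
def G52.br (x y : Fin 5 → ℝ) : Fin 5 → ℝ := ![0, 0, 0, minor 0 1 x y, minor 0 2 x y]

/-- The bracket of `g_{6,4}` in coordinates. -/
def G64.br (x y : Fin 6 → ℝ) : Fin 6 → ℝ :=
  ![0, 0, 0, 0, minor 0 1 x y + minor 2 3 x y, minor 0 2 x y]

/-- The bracket of `g_{6,5}` in coordinates. -/
def G65.br (x y : Fin 6 → ℝ) : Fin 6 → ℝ :=
  ![0, 0, 0, 0, minor 0 1 x y - minor 2 3 x y, minor 0 2 x y + minor 1 3 x y]

instance : LieRing H1 where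
  bracket x y := H1.br x y
  add_lie x y z := by
    change H1.br (fun i => x i + y i) z = fun i => H1.br x z i + H1.br y z i
    funext i; fin_cases i <;> simp [H1.br, minor]; ring
  lie_add x y z := by
    change H1.br x (fun i => y i + z i) = fun i => H1.br x y i + H1.br x z i
    funext i; fin_cases i <;> simp [H1.br, minor]; ring
  lie_self x := by
    change H1.br x x = fun _ => 0
    funext i; fin_cases i <;> simp [H1.br, minor]; ring
  leibniz_lie x y z := by
    change H1.br x (H1.br y z) = fun i => H1.br (H1.br x y) z i + H1.br y (H1.br x z) i
    funext i; fin_cases i <;> simp [H1.br, minor]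

instance : LieAlgebra ℝ H1 where
  lie_smul t x y := by
    change H1.br x (fun i => t * y i) = fun i => t * H1.br x y i
    funext i; fin_cases i <;> simp [H1.br, minor]; ring

instance : LieRing G41 where
  bracket x y := G41.br x y
  add_lie x y z := by
    change G41.br (fun i => x i + y i) z = fun i => G41.br x z i + G41.br y z i
    funext i; fin_cases i <;> simp [G41.br, minor] <;> ring
  lie_add x y z := by
    change G41.br x (fun i => y i + z i) = fun i => G41.br x y i + G41.br x z i
    funext i; fin_cases i <;> simp [G41.br, minor] <;> ring
  lie_self x := by
    change G41.br x x = fun _ => 0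
    funext i; fin_cases i <;> simp [G41.br, minor] <;> ring
  leibniz_lie x y z := by
    change G41.br x (G41.br y z) = fun i => G41.br (G41.br x y) z i + G41.br y (G41.br x z) i
    funext i; fin_cases i <;> simp [G41.br, minor]; ring

instance : LieAlgebra ℝ G41 where
  lie_smul t x y := by
    change G41.br x (fun i => t * y i) = fun i => t * G41.br x y i
    funext i; fin_cases i <;> simp [G41.br, minor] <;> ring

instance : LieRing G52 where
  bracket x y := G52.br x y
  add_lie x y z := by
    change G52.br (fun i => x i + y i) z = fun i => G52.br x z i + G52.br y z i
    funext i; fin_cases i <;> simp [G52.br, minor] <;> ring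
  lie_add x y z := by
    change G52.br x (fun i => y i + z i) = fun i => G52.br x y i + G52.br x z i
    funext i; fin_cases i <;> simp [G52.br, minor] <;> ring
  lie_self x := by
    change G52.br x x = fun _ => 0
    funext i; fin_cases i <;> simp [G52.br, minor] <;> ring
  leibniz_lie x y z := by
    change G52.br x (G52.br y z) = fun i => G52.br (G52.br x y) z i + G52.br y (G52.br x z) i
    funext i; fin_cases i <;> simp [G52.br, minor]

instance : LieAlgebra ℝ G52 where
  lie_smul t x y := by
    change G52.br x (fun i => t * y i) = fun i => t * G52.br x y i
    funext i; fin_cases i <;> simp [G52.br, minor] <;> ring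

instance : LieRing G64 where
  bracket x y := G64.br x y
  add_lie x y z := by
    change G64.br (fun i => x i + y i) z = fun i => G64.br x z i + G64.br y z i
    funext i; fin_cases i <;> simp [G64.br, minor] <;> ring
  lie_add x y z := by
    change G64.br x (fun i => y i + z i) = fun i => G64.br x y i + G64.br x z i
    funext i; fin_cases i <;> simp [G64.br, minor] <;> ring
  lie_self x := by
    change G64.br x x = fun _ => 0
    funext i; fin_cases i <;> simp [G64.br, minor] <;> ring
  leibniz_lie x y z := by
    change G64.br x (G64.br y z) = fun i => G64.br (G64.br x y) z i + G64.br y (G64.br x z) i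
    funext i; fin_cases i <;> simp [G64.br, minor]

instance : LieAlgebra ℝ G64 where
  lie_smul t x y := by
    change G64.br x (fun i => t * y i) = fun i => t * G64.br x y i
    funext i; fin_cases i <;> simp [G64.br, minor] <;> ring

instance : LieRing G65 where
  bracket x y := G65.br x y
  add_lie x y z := by
    change G65.br (fun i => x i + y i) z = fun i => G65.br x z i + G65.br y z i
    funext i; fin_cases i <;> simp [G65.br, minor] <;> ring
  lie_add x y z := by
    change G65.br x (fun i => y i + z i) = fun i => G65.br x y i + G65.br x z i
    funext i; fin_cases i <;> simp [G65.br, minor] <;> ring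
  lie_self x := by
    change G65.br x x = fun _ => 0
    funext i; fin_cases i <;> simp [G65.br, minor] <;> ring
  leibniz_lie x y z := by
    change G65.br x (G65.br y z) = fun i => G65.br (G65.br x y) z i + G65.br y (G65.br x z) i
    funext i; fin_cases i <;> simp [G65.br, minor]

instance : LieAlgebra ℝ G65 where
  lie_smul t x y := by
    change G65.br x (fun i => t * y i) = fun i => t * G65.br x y i
    funext i; fin_cases i <;> simp [G65.br, minor] <;> ring

instance (k : ℕ) : LieRing (Rab k) where
  bracket _ _ := 0
  add_lie _ _ _ := (add_zero 0).symm
  lie_add _ _ _ := (add_zero 0).symm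
  lie_self _ := rfl
  leibniz_lie _ _ _ := (add_zero 0).symm

instance (k : ℕ) : LieAlgebra ℝ (Rab k) where
  lie_smul t _ _ := (smul_zero t).symm

end QuadLie

/-! For a basis `Y`, `Z` of the derived algebra with coordinate functionals `η`, `ζ`, the bracket is
encoded by the two linearly independent 2-forms `η ⁅x, y⁆`, `ζ ⁅x, y⁆`. The abelian factor splits
off (`nonempty_equiv_prod_of_injOn`), so it is enough to bring this pencil of 2-forms to a normal
form.

Two-step case. Put `C = α(Y,·)`, `D = α(Z,·)`. Closedness of `α` says `η ∧ C + ζ ∧ D = 0`, and the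
equation for `dγ` makes `⟨C x, D y⟩` symmetric in `x`, `y`. If some pairing with `A₀` turns `C`, `D`
into independent functionals `a`, `b`, then `η = a ∧ p' + b ∧ p` and `ζ = a ∧ p + b ∧ q`. Were `a,
b, p, p', q` independent, `C` and `D` would be `a` and `b` times one isotropic vector, which `(B_1)`
excludes. Hence `p', p, q` satisfy a relation modulo `a`, `b`, a quadratic equation in disguise: two
real roots, a double root or complex roots give `h(1) ⊕ h(1)`, `g_{6,4}` or `g_{6,5}`, and
degenerate configurations give `g_{5,2}` (`isListed_of_indep_pair`). If no `A₀` yields independent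
functionals, either the two forms have a common linear factor, which means `g_{5,2}`
(`isListed_of_dependent_pairs`), or `α` kills some nonzero vector of the derived algebra and `(A_1)`
makes `γ` supply the missing functional (`isListed_of_left_zero`).

Three-step case. Now `l^3` is a line, and `(A_2)`, `(B_2)` make the vector that spans the values of
`α` on it non-isotropic. Together with the Jacobi identity this gives both forms a common factor,
hence `g_{4,1}` (`isListed_of_three_step`).

Conversely, `isAdmissible_of_forms` reduces admissibility to explicit real forms; the factor `ℝ^k`
is handled by letting it act faithfully by rotations. -/

namespace QuadLie

/-! ### Splitting off the abelian factor and recognising the listed algebras from functionals -/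

section Classification

variable {L : Type*} [LieRing L] [LieAlgebra ℝ L]

/-- A proper range would lie in the kernel of a nonzero functional, and the coordinates of that
functional form a linear relation among the `F i`. -/
theorem exists_apply_eq_of_linearIndependent {V : Type*} [AddCommGroup V] [Module ℝ V] {n : ℕ}
    (F : Fin n → V →ₗ[ℝ] ℝ)
    (hF : ∀ c : Fin n → ℝ, (∀ x, ∑ i, c i * F i x = 0) → c = 0) (v : Fin n → ℝ) :
    ∃ x, ∀ i, F i x = v i := by
  by_contra hcon
  have hlt : LinearMap.range (LinearMap.pi F) < ⊤ := by
    rw [lt_top_iff_ne_top]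
    intro h
    obtain ⟨x, hx⟩ := (LinearMap.range_eq_top.1 h) v
    exact hcon ⟨x, fun i => by rw [← hx]; rfl⟩
  obtain ⟨g, hg, hle⟩ := Submodule.exists_le_ker_of_lt_top _ hlt
  apply hg
  have key : (fun i => g (Pi.single i 1)) = 0 := by
    apply hF
    intro x
    have h1 : g (LinearMap.pi F x) = 0 := hle ⟨x, rfl⟩
    rw [← LinearMap.sum_single_apply (fun _ => ℝ) (LinearMap.pi F x), map_sum] at h1
    rw [← h1]
    refine Finset.sum_congr rfl fun i _ => ?_
    have h2 : Pi.single i (LinearMap.pi F x i) = (F i x) • (Pi.single i (1 : ℝ) : Fin n → ℝ) := by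
      rw [← Pi.single_smul]; simp
    rw [h2, map_smul, smul_eq_mul, mul_comm]
  ext i
  simpa using congrFun key i

/-- A Lie algebra homomorphism that is surjective, and injective on the derived algebra, splits
off an abelian factor. -/
theorem nonempty_equiv_prod_of_injOn [FiniteDimensional ℝ L] {G : Type*} [LieRing G]
    [LieAlgebra ℝ G] (φ : L →ₗ⁅ℝ⁆ G) (hs : Function.Surjective φ)
    (hi : ∀ u ∈ LieModule.lowerCentralSeries ℝ L L 1, φ u = 0 → u = 0) :
    ∃ k : ℕ, Nonempty (L ≃ₗ⁅ℝ⁆ G × Rab k) := by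
  set D : Submodule ℝ L := (LieModule.lowerCentralSeries ℝ L L 1).toSubmodule with hD
  set K : Submodule ℝ L := LinearMap.ker (φ : L →ₗ[ℝ] G) with hK
  have hdisj : Disjoint K D := by
    rw [Submodule.disjoint_def]
    intro x hx hx'
    exact hi x hx' hx
  -- The complement of the kernel is chosen to contain the derived algebra. The projection onto the
  -- kernel then kills every bracket, so it is a homomorphism to an abelian algebra.
  obtain ⟨D', hDD', hc⟩ := hdisj.symm.exists_isCompl
  have hbr : ∀ x y : L, ⁅x, y⁆ ∈ D := fun x y =>
    LieSubmodule.lie_mem_lie (LieSubmodule.mem_top x) (LieSubmodule.mem_top y)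
  set P := K.projectionOnto D' hc.symm with hP
  have hPD : ∀ x y : L, P ⁅x, y⁆ = 0 := fun x y =>
    (Submodule.projectionOnto_apply_eq_zero_iff hc.symm).2 (hDD' (hbr x y))
  let e : K ≃ₗ[ℝ] (Fin (Module.finrank ℝ K) → ℝ) :=
    LinearEquiv.ofFinrankEq _ _ (by simp)
  let Φ : L →ₗ[ℝ] G × Rab (Module.finrank ℝ K) :=
    (φ : L →ₗ[ℝ] G).prod ((e : K →ₗ[ℝ] (Fin (Module.finrank ℝ K) → ℝ)) ∘ₗ P)
  have hΦ : ∀ x, Φ x = (φ x, e (P x)) := fun x => rfl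
  have hinj : Function.Injective Φ := by
    rw [injective_iff_map_eq_zero]
    intro x hx
    have h1 : P x = 0 := e.map_eq_zero_iff.1 (congrArg Prod.snd hx)
    have h2 : (P x : L) = x :=
      congrArg Subtype.val (Submodule.projectionOnto_apply_left hc.symm ⟨x, congrArg Prod.fst hx⟩)
    rw [← h2, h1]; rfl
  have hsurj : Function.Surjective Φ := by
    rintro ⟨g, v⟩
    obtain ⟨x, rfl⟩ := hs g
    refine ⟨x + ((e.symm v - P x : K) : L), ?_⟩
    have h2 : ∀ u : K, P (u : L) = u := fun u => Submodule.projectionOnto_apply_left hc.symm u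
    have h3 : ∀ u : K, φ (u : L) = 0 := fun u => u.2
    rw [hΦ, map_add, map_add, h2, h3, add_zero, add_sub_cancel]
    exact congrArg (Prod.mk (φ x)) (e.apply_symm_apply v)
  let E := LinearEquiv.ofBijective Φ ⟨hinj, hsurj⟩
  refine ⟨_, ⟨{ E with map_lie' := ?_ }⟩⟩
  intro x y
  change Φ ⁅x, y⁆ = ⁅Φ x, Φ y⁆
  rw [hΦ, hPD, map_zero, hΦ, hΦ, LieHom.map_lie]
  rfl

/-- Two functionals that restrict to a coordinate system of the derived algebra. -/
structure IsFrame (η ζ : L →ₗ[ℝ] ℝ) : Prop where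
  indep : ∀ c d : ℝ, (∀ x y : L, c * η ⁅x, y⁆ + d * ζ ⁅x, y⁆ = 0) → c = 0 ∧ d = 0
  inj : ∀ u ∈ LieModule.lowerCentralSeries ℝ L L 1, η u = 0 → ζ u = 0 → u = 0

variable (L) in
/-- The conclusion of the classification. -/
def IsListed : Prop :=
  ∃ k : ℕ,
    Nonempty (L ≃ₗ⁅ℝ⁆ (H1 × H1) × Rab k) ∨ Nonempty (L ≃ₗ⁅ℝ⁆ G41 × Rab k) ∨
    Nonempty (L ≃ₗ⁅ℝ⁆ G52 × Rab k) ∨ Nonempty (L ≃ₗ⁅ℝ⁆ G64 × Rab k) ∨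
    Nonempty (L ≃ₗ⁅ℝ⁆ G65 × Rab k)

variable {η ζ : L →ₗ[ℝ] ℝ}

theorem IsFrame.isListed_of_g41 [FiniteDimensional ℝ L] (h : IsFrame η ζ) (f g : L →ₗ[ℝ] ℝ)
    (h1 : ∀ x y : L, η ⁅x, y⁆ = f x * ζ y - f y * ζ x) (h2 : ∀ x y : L, ζ ⁅x, y⁆ = f x * g y - f y * g x)
    (hf : ∀ x y : L, f ⁅x, y⁆ = 0) (hg : ∀ x y : L, g ⁅x, y⁆ = 0) : IsListed L := by
  let φ : L →ₗ⁅ℝ⁆ G41 :=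
    { toLinearMap := (LinearMap.pi ![f, g, η, ζ] : L →ₗ[ℝ] (Fin 4 → ℝ))
      map_lie' := by
        intro x y
        change LinearMap.pi ![f, g, η, ζ] ⁅x, y⁆
          = G41.br (LinearMap.pi ![f, g, η, ζ] x) (LinearMap.pi ![f, g, η, ζ] y)
        funext i
        fin_cases i <;> simp [G41.br, minor, hf, hg, h1, h2] <;> ring }
  have hs : Function.Surjective φ := by
    intro v
    obtain ⟨x, hx⟩ := exists_apply_eq_of_linearIndependent ![f, g, η, ζ] (fun c hc => by
      simp only [Fin.sum_univ_four, Matrix.cons_val] at hc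
      obtain ⟨h3, h4⟩ := h.indep (c 2) (c 3) fun x y => by
        have := hc ⁅x, y⁆
        rw [hf, hg] at this
        linarith
      -- The remaining relation `c 0 • f + c 1 • g = 0` is wedged with `g`, and below with `f`; both
      -- results are multiples of `ζ ⁅x, y⁆`.
      have h5 : ∀ x y : L, c 0 * (f x * g y - f y * g x) = 0 := fun x y => by
        have e1 := hc x
        have e2 := hc y
        rw [h3, h4] at e1 e2
        linear_combination e1 * g y - e2 * g x
      have h6 : c 0 = 0 := (h.indep 0 (c 0) fun x y => by rw [h2]; linear_combination h5 x y).2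
      have h7 : c 1 = 0 := (h.indep 0 (c 1) fun x y => by
        have e1 := hc x
        have e2 := hc y
        rw [h3, h4, h6] at e1 e2
        rw [h2]; linear_combination e2 * f x - e1 * f y).2
      funext i
      fin_cases i <;> assumption) v
    exact ⟨x, funext hx⟩
  obtain ⟨k, hk⟩ := nonempty_equiv_prod_of_injOn φ hs fun u hu hu0 =>
    h.inj u hu (congrFun hu0 2) (congrFun hu0 3)
  exact ⟨k, Or.inr (Or.inl hk)⟩

theorem IsFrame.isListed_of_g52 [FiniteDimensional ℝ L] (h : IsFrame η ζ) (f g j : L →ₗ[ℝ] ℝ)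
    (h1 : ∀ x y : L, η ⁅x, y⁆ = f x * g y - f y * g x) (h2 : ∀ x y : L, ζ ⁅x, y⁆ = f x * j y - f y * j x)
    (hi : ∀ r s t : ℝ, (∀ x, r * f x + s * g x + t * j x = 0) → r = 0 ∧ s = 0 ∧ t = 0)
    (hc : ∀ x y z : L, ⁅⁅x, y⁆, z⁆ = 0) : IsListed L := by
  -- Double brackets vanish, so contracting `f ∧ g` with `⁅x, y⁆` gives zero, a linear relation with
  -- coefficients `f ⁅x, y⁆`, `g ⁅x, y⁆`. The same device is used in the other two-step algebras.
  have hfg : ∀ x y : L, f ⁅x, y⁆ = 0 ∧ g ⁅x, y⁆ = 0 := fun x y => by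
    obtain ⟨r1, r2, -⟩ := hi (-g ⁅x, y⁆) (f ⁅x, y⁆) 0 fun z => by
      have := h1 ⁅x, y⁆ z
      rw [hc, map_zero] at this
      linear_combination -this
    exact ⟨r2, neg_eq_zero.1 r1⟩
  have hj : ∀ x y : L, j ⁅x, y⁆ = 0 := fun x y => by
    obtain ⟨r1, -⟩ := hi (-j ⁅x, y⁆) 0 (f ⁅x, y⁆) fun z => by
      have := h2 ⁅x, y⁆ z
      rw [hc, map_zero] at this
      linear_combination -this
    exact neg_eq_zero.1 r1
  let φ : L →ₗ⁅ℝ⁆ G52 :=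
    { toLinearMap := (LinearMap.pi ![f, g, j, η, ζ] : L →ₗ[ℝ] (Fin 5 → ℝ))
      map_lie' := by
        intro x y
        change LinearMap.pi ![f, g, j, η, ζ] ⁅x, y⁆
          = G52.br (LinearMap.pi ![f, g, j, η, ζ] x) (LinearMap.pi ![f, g, j, η, ζ] y)
        funext i
        fin_cases i <;> simp [G52.br, minor, hfg, hj, h1, h2] <;> ring }
  have hs : Function.Surjective φ := by
    intro v
    obtain ⟨x, hx⟩ := exists_apply_eq_of_linearIndependent ![f, g, j, η, ζ] (fun c hc => by
      simp only [Fin.sum_univ_five, Matrix.cons_val] at hc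
      obtain ⟨h3, h4⟩ := h.indep (c 3) (c 4) fun x y => by
        have := hc ⁅x, y⁆
        rw [(hfg x y).1, (hfg x y).2, hj] at this
        linarith
      obtain ⟨h5, h6, h7⟩ := hi (c 0) (c 1) (c 2) fun x => by
        have := hc x
        rw [h3, h4] at this
        linarith
      funext i
      fin_cases i <;> assumption) v
    exact ⟨x, funext hx⟩
  obtain ⟨k, hk⟩ := nonempty_equiv_prod_of_injOn φ hs fun u hu hu0 =>
    h.inj u hu (congrFun hu0 3) (congrFun hu0 4)
  exact ⟨k, Or.inr (Or.inr (Or.inl hk))⟩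

/-- Linear independence of four functionals. -/
def Indep₄ (a p b q : L →ₗ[ℝ] ℝ) : Prop :=
  ∀ r s t u : ℝ, (∀ x, r * a x + s * p x + t * b x + u * q x = 0) →
    r = 0 ∧ s = 0 ∧ t = 0 ∧ u = 0

theorem IsFrame.exists_apply_eq (h : IsFrame η ζ) {a p b q : L →ₗ[ℝ] ℝ} (hi : Indep₄ a p b q)
    (hz : ∀ x y : L, a ⁅x, y⁆ = 0 ∧ p ⁅x, y⁆ = 0 ∧ b ⁅x, y⁆ = 0 ∧ q ⁅x, y⁆ = 0) (v : Fin 6 → ℝ) :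
    ∃ x, ∀ i, (![a, p, b, q, η, ζ] : Fin 6 → L →ₗ[ℝ] ℝ) i x = v i := by
  refine exists_apply_eq_of_linearIndependent _ (fun c hc => ?_) v
  simp only [Fin.sum_univ_six, Matrix.cons_val] at hc
  obtain ⟨h3, h4⟩ := h.indep (c 4) (c 5) fun x y => by
    have := hc ⁅x, y⁆
    obtain ⟨e1, e2, e3, e4⟩ := hz x y
    rw [e1, e2, e3, e4] at this
    linarith
  obtain ⟨h5, h6, h7, h8⟩ := hi (c 0) (c 1) (c 2) (c 3) fun x => by
    have := hc x
    rw [h3, h4] at this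
    linarith
  funext i
  fin_cases i <;> assumption

theorem IsFrame.isListed_of_h1_h1 [FiniteDimensional ℝ L] (h : IsFrame η ζ)
    (a p b q : L →ₗ[ℝ] ℝ) (h1 : ∀ x y : L, η ⁅x, y⁆ = a x * p y - a y * p x)
    (h2 : ∀ x y : L, ζ ⁅x, y⁆ = b x * q y - b y * q x) (hi : Indep₄ a p b q)
    (hc : ∀ x y z : L, ⁅⁅x, y⁆, z⁆ = 0) : IsListed L := by
  have hz : ∀ x y : L, a ⁅x, y⁆ = 0 ∧ p ⁅x, y⁆ = 0 ∧ b ⁅x, y⁆ = 0 ∧ q ⁅x, y⁆ = 0 := fun x y => by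
    obtain ⟨r1, r2, -⟩ := hi (-p ⁅x, y⁆) (a ⁅x, y⁆) 0 0 fun z => by
      have := h1 ⁅x, y⁆ z
      rw [hc, map_zero] at this
      linear_combination -this
    obtain ⟨-, -, r3, r4⟩ := hi 0 0 (-q ⁅x, y⁆) (b ⁅x, y⁆) fun z => by
      have := h2 ⁅x, y⁆ z
      rw [hc, map_zero] at this
      linear_combination -this
    exact ⟨r2, neg_eq_zero.1 r1, r4, neg_eq_zero.1 r3⟩
  let φ : L →ₗ⁅ℝ⁆ H1 × H1 :=
    { toLinearMap := (LinearMap.pi ![a, p, η] : L →ₗ[ℝ] (Fin 3 → ℝ)).prod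
        (LinearMap.pi ![b, q, ζ] : L →ₗ[ℝ] (Fin 3 → ℝ))
      map_lie' := by
        intro x y
        change ((LinearMap.pi ![a, p, η] ⁅x, y⁆, LinearMap.pi ![b, q, ζ] ⁅x, y⁆) :
            (Fin 3 → ℝ) × (Fin 3 → ℝ))
          = (H1.br (LinearMap.pi ![a, p, η] x) (LinearMap.pi ![a, p, η] y),
            H1.br (LinearMap.pi ![b, q, ζ] x) (LinearMap.pi ![b, q, ζ] y))
        congr 1 <;> funext i <;> fin_cases i <;> simp [H1.br, minor, hz, h1, h2, mul_comm] }
  have hs : Function.Surjective φ := by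
    rintro ⟨v, w⟩
    obtain ⟨x, hx⟩ := h.exists_apply_eq hi hz
      ![(v : Fin 3 → ℝ) 0, (v : Fin 3 → ℝ) 1, (w : Fin 3 → ℝ) 0, (w : Fin 3 → ℝ) 1,
        (v : Fin 3 → ℝ) 2, (w : Fin 3 → ℝ) 2]
    refine ⟨x, Prod.ext (funext fun i => ?_) (funext fun i => ?_)⟩
    · fin_cases i
      · exact hx 0
      · exact hx 1
      · exact hx 4
    · fin_cases i
      · exact hx 2
      · exact hx 3
      · exact hx 5
  obtain ⟨k, hk⟩ := nonempty_equiv_prod_of_injOn φ hs fun u hu hu0 =>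
    h.inj u hu (congrFun (congrArg Prod.fst hu0) 2) (congrFun (congrArg Prod.snd hu0) 2)
  exact ⟨k, Or.inl hk⟩

theorem IsFrame.isListed_of_g64 [FiniteDimensional ℝ L] (h : IsFrame η ζ)
    (a p b q : L →ₗ[ℝ] ℝ)
    (h1 : ∀ x y : L, η ⁅x, y⁆ = (a x * p y - a y * p x) + (b x * q y - b y * q x))
    (h2 : ∀ x y : L, ζ ⁅x, y⁆ = a x * b y - a y * b x) (hi : Indep₄ a p b q)
    (hc : ∀ x y z : L, ⁅⁅x, y⁆, z⁆ = 0) : IsListed L := by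
  have hz : ∀ x y : L, a ⁅x, y⁆ = 0 ∧ p ⁅x, y⁆ = 0 ∧ b ⁅x, y⁆ = 0 ∧ q ⁅x, y⁆ = 0 := fun x y => by
    obtain ⟨r1, r2, r3, r4⟩ := hi (-p ⁅x, y⁆) (a ⁅x, y⁆) (-q ⁅x, y⁆) (b ⁅x, y⁆) fun z => by
      have := h1 ⁅x, y⁆ z
      rw [hc, map_zero] at this
      linear_combination -this
    exact ⟨r2, neg_eq_zero.1 r1, r4, neg_eq_zero.1 r3⟩
  let φ : L →ₗ⁅ℝ⁆ G64 :=
    { toLinearMap := (LinearMap.pi ![a, p, b, q, η, ζ] : L →ₗ[ℝ] (Fin 6 → ℝ))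
      map_lie' := by
        intro x y
        change LinearMap.pi ![a, p, b, q, η, ζ] ⁅x, y⁆
          = G64.br (LinearMap.pi ![a, p, b, q, η, ζ] x) (LinearMap.pi ![a, p, b, q, η, ζ] y)
        funext i
        fin_cases i <;> simp [G64.br, minor, hz, h1, h2] <;> ring }
  obtain ⟨k, hk⟩ := nonempty_equiv_prod_of_injOn φ
    (fun v => (h.exists_apply_eq hi hz v).imp fun x hx => funext hx) fun u hu hu0 =>
    h.inj u hu (congrFun hu0 4) (congrFun hu0 5)
  exact ⟨k, Or.inr (Or.inr (Or.inr (Or.inl hk)))⟩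

theorem IsFrame.isListed_of_g65 [FiniteDimensional ℝ L] (h : IsFrame η ζ)
    (a p b q : L →ₗ[ℝ] ℝ)
    (h1 : ∀ x y : L, η ⁅x, y⁆ = (a x * p y - a y * p x) - (b x * q y - b y * q x))
    (h2 : ∀ x y : L, ζ ⁅x, y⁆ = (a x * b y - a y * b x) + (p x * q y - p y * q x))
    (hi : Indep₄ a p b q) (hc : ∀ x y z : L, ⁅⁅x, y⁆, z⁆ = 0) : IsListed L := by
  have hz : ∀ x y : L, a ⁅x, y⁆ = 0 ∧ p ⁅x, y⁆ = 0 ∧ b ⁅x, y⁆ = 0 ∧ q ⁅x, y⁆ = 0 := fun x y => by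
    obtain ⟨r1, r2, r3, r4⟩ := hi (-p ⁅x, y⁆) (a ⁅x, y⁆) (q ⁅x, y⁆) (-b ⁅x, y⁆) fun z => by
      have := h1 ⁅x, y⁆ z
      rw [hc, map_zero] at this
      linear_combination -this
    exact ⟨r2, neg_eq_zero.1 r1, neg_eq_zero.1 r4, r3⟩
  let φ : L →ₗ⁅ℝ⁆ G65 :=
    { toLinearMap := (LinearMap.pi ![a, p, b, q, η, ζ] : L →ₗ[ℝ] (Fin 6 → ℝ))
      map_lie' := by
        intro x y
        change LinearMap.pi ![a, p, b, q, η, ζ] ⁅x, y⁆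
          = G65.br (LinearMap.pi ![a, p, b, q, η, ζ] x) (LinearMap.pi ![a, p, b, q, η, ζ] y)
        funext i
        fin_cases i <;> simp [G65.br, minor, hz, h1, h2] <;> ring }
  obtain ⟨k, hk⟩ := nonempty_equiv_prod_of_injOn φ
    (fun v => (h.exists_apply_eq hi hz v).imp fun x hx => funext hx) fun u hu hu0 =>
    h.inj u hu (congrFun hu0 4) (congrFun hu0 5)
  exact ⟨k, Or.inr (Or.inr (Or.inr (Or.inr hk)))⟩

end Classification

/-! ### Normal forms of pencils of 2-forms -/

section PencilClassification

variable {L : Type*} [LieRing L] [LieAlgebra ℝ L] {η ζ : L →ₗ[ℝ] ℝ}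

theorem IsFrame.change (h : IsFrame η ζ) (r s t u : ℝ) (hd : r * u - s * t ≠ 0) :
    IsFrame (r • η + s • ζ) (t • η + u • ζ) := by
  refine ⟨fun c d hcd => ?_, fun x hx h1 h2 => ?_⟩
  · obtain ⟨e1, e2⟩ := h.indep (c * r + d * t) (c * s + d * u) fun x y => by
      have := hcd x y
      simp only [LinearMap.add_apply, LinearMap.smul_apply, smul_eq_mul] at this
      linear_combination this
    constructor
    · exact (mul_eq_zero.1 (by linear_combination u * e1 - t * e2 :
        (r * u - s * t) * c = 0)).resolve_left hd
    · exact (mul_eq_zero.1 (by linear_combination r * e2 - s * e1 :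
        (r * u - s * t) * d = 0)).resolve_left hd
  · simp only [LinearMap.add_apply, LinearMap.smul_apply, smul_eq_mul] at h1 h2
    refine h.inj x hx ?_ ?_
    · exact (mul_eq_zero.1 (by linear_combination u * h1 - s * h2 :
        (r * u - s * t) * η x = 0)).resolve_left hd
    · exact (mul_eq_zero.1 (by linear_combination r * h2 - t * h1 :
        (r * u - s * t) * ζ x = 0)).resolve_left hd

theorem IsFrame.swap (h : IsFrame η ζ) : IsFrame ζ η := by
  simpa using h.change 0 1 1 0 (by norm_num)

variable [FiniteDimensional ℝ L]

/-- A 2-form `θ` with `f ∧ θ = 0` equals `f ∧ g`, where `g` is its contraction with `x₀` divided by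
`f x₀`. A relation among the resulting functionals, wedged with `f`, would be one between the two
forms. -/
theorem IsFrame.isListed_of_common_factor (h : IsFrame η ζ) (hc : ∀ x y z : L, ⁅⁅x, y⁆, z⁆ = 0)
    (f : L →ₗ[ℝ] ℝ) (x₀ : L) (hf : f x₀ ≠ 0)
    (h1 : ∀ x y z : L, f x * η ⁅y, z⁆ + f y * η ⁅z, x⁆ + f z * η ⁅x, y⁆ = 0)
    (h2 : ∀ x y z : L, f x * ζ ⁅y, z⁆ + f y * ζ ⁅z, x⁆ + f z * ζ ⁅x, y⁆ = 0) : IsListed L := by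
  have hs : ∀ (θ : L →ₗ[ℝ] ℝ) (x y : L), θ ⁅x, y⁆ = -θ ⁅y, x⁆ := fun θ x y => by
    rw [← lie_skew, map_neg]
  let g (θ : L →ₗ[ℝ] ℝ) : L →ₗ[ℝ] ℝ := (f x₀)⁻¹ • θ ∘ₗ (LieModule.toEnd ℝ L L x₀)
  have hg : ∀ θ x, g θ x = (f x₀)⁻¹ * θ ⁅x₀, x⁆ := fun θ x => rfl
  have key : ∀ θ : L →ₗ[ℝ] ℝ,
      (∀ x y z : L, f x * θ ⁅y, z⁆ + f y * θ ⁅z, x⁆ + f z * θ ⁅x, y⁆ = 0) →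
      ∀ x y, θ ⁅x, y⁆ = f x * g θ y - f y * g θ x := fun θ hθ x y => by
    have := hθ x₀ x y
    rw [hs θ y x₀] at this
    rw [hg, hg]
    field_simp
    linear_combination this
  refine h.isListed_of_g52 f (g η) (g ζ) (key η h1) (key ζ h2) (fun r s t hr => ?_) hc
  have hr0 : r = 0 := by
    have := hr x₀
    rw [hg, hg, lie_self, map_zero, map_zero] at this
    simpa [hf] using this
  subst hr0
  obtain ⟨e1, e2⟩ := h.indep s t fun x y => by
    rw [key η h1, key ζ h2]
    linear_combination f x * hr y - f y * hr x
  exact ⟨rfl, e1, e2⟩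

/-- 2-forms in three functionals correspond to vectors `u`, `w` of `ℝ³`, and the cross product `u ×
w` gives the coefficients of a common linear factor. The functionals `e i` may be dependent, so it
must be shown separately that this factor is nonzero. -/
theorem IsFrame.isListed_of_span₃ (h : IsFrame η ζ) (hc : ∀ x y z : L, ⁅⁅x, y⁆, z⁆ = 0)
    (e : Fin 3 → L →ₗ[ℝ] ℝ) (M N : Fin 3 → Fin 3 → ℝ)
    (h1 : ∀ x y, η ⁅x, y⁆ = ∑ i, ∑ j, M i j * (e i x * e j y))
    (h2 : ∀ x y, ζ ⁅x, y⁆ = ∑ i, ∑ j, N i j * (e i x * e j y)) : IsListed L := by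
  have norm : ∀ (θ : L →ₗ[ℝ] ℝ) (M : Fin 3 → Fin 3 → ℝ),
      (∀ x y, θ ⁅x, y⁆ = ∑ i, ∑ j, M i j * (e i x * e j y)) →
      ∃ u v w : ℝ, ∀ x y, θ ⁅x, y⁆ = u * (e 1 x * e 2 y - e 1 y * e 2 x)
        + v * (e 2 x * e 0 y - e 2 y * e 0 x) + w * (e 0 x * e 1 y - e 0 y * e 1 x) := by
    intro θ M hM
    refine ⟨(M 1 2 - M 2 1) / 2, (M 2 0 - M 0 2) / 2, (M 0 1 - M 1 0) / 2, fun x y => ?_⟩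
    have e1 := hM x y
    have e2 := hM y x
    rw [← lie_skew, map_neg] at e2
    simp only [Fin.sum_univ_three] at e1 e2
    linear_combination (e1 - e2) / 2
  obtain ⟨u0, u1, u2, hu⟩ := norm η M h1
  obtain ⟨w0, w1, w2, hw⟩ := norm ζ N h2
  set r0 := u1 * w2 - u2 * w1 with hr0
  set r1 := u2 * w0 - u0 * w2 with hr1
  set r2 := u0 * w1 - u1 * w0 with hr2
  let f : L →ₗ[ℝ] ℝ := r0 • e 0 + r1 • e 1 + r2 • e 2
  have hfx : ∀ x, f x = r0 * e 0 x + r1 * e 1 x + r2 * e 2 x := fun x => rfl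
  by_cases hf : ∃ x, f x ≠ 0
  · obtain ⟨x₀, hx₀⟩ := hf
    refine h.isListed_of_common_factor hc f x₀ hx₀ (fun x y z => ?_) (fun x y z => ?_)
    · rw [hu, hu, hu, hfx, hfx, hfx, hr0, hr1, hr2]; ring
    · rw [hw, hw, hw, hfx, hfx, hfx, hr0, hr1, hr2]; ring
  exfalso
  push Not at hf
  have hf' : ∀ x, r0 * e 0 x + r1 * e 1 x + r2 * e 2 x = 0 := hf
  -- If the factor vanishes as a functional, then `u ⬝ r = 0` gives `r i • η = 0` on brackets, so `u
  -- × w = 0`. The two forms are then proportional, against their independence.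
  have z0 : r0 = 0 := (h.indep r0 0 fun x y => by
    rw [hu]
    have e1 := hf' x
    have e2 := hf' y
    linear_combination u1 * (e 2 x * e2 - e 2 y * e1) - u2 * (e 1 x * e2 - e 1 y * e1)
      + (e 1 x * e 2 y - e 1 y * e 2 x) *
        (by rw [hr0, hr1, hr2]; ring : u0 * r0 + u1 * r1 + u2 * r2 = 0)).1
  have z1 : r1 = 0 := (h.indep r1 0 fun x y => by
    rw [hu]
    have e1 := hf' x
    have e2 := hf' y
    linear_combination u2 * (e 0 x * e2 - e 0 y * e1) - u0 * (e 2 x * e2 - e 2 y * e1)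
      + (e 2 x * e 0 y - e 2 y * e 0 x) *
        (by rw [hr0, hr1, hr2]; ring : u0 * r0 + u1 * r1 + u2 * r2 = 0)).1
  have z2 : r2 = 0 := (h.indep r2 0 fun x y => by
    rw [hu]
    have e1 := hf' x
    have e2 := hf' y
    linear_combination u0 * (e 1 x * e2 - e 1 y * e1) - u1 * (e 0 x * e2 - e 0 y * e1)
      + (e 0 x * e 1 y - e 0 y * e 1 x) *
        (by rw [hr0, hr1, hr2]; ring : u0 * r0 + u1 * r1 + u2 * r2 = 0)).1
  rw [z0] at hr0
  rw [z1] at hr1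
  rw [z2] at hr2
  have a0 : u0 = 0 := by
    have := (h.indep w0 (-u0) fun x y => by
      rw [hu, hw]
      linear_combination -(e 2 x * e 0 y - e 2 y * e 0 x) * hr2.symm
        + (e 0 x * e 1 y - e 0 y * e 1 x) * hr1.symm).2
    linarith
  have a1 : u1 = 0 := by
    have := (h.indep w1 (-u1) fun x y => by
      rw [hu, hw]
      linear_combination (e 1 x * e 2 y - e 1 y * e 2 x) * hr2.symm
        - (e 0 x * e 1 y - e 0 y * e 1 x) * hr0.symm).2
    linarith
  have a2 : u2 = 0 := by
    have := (h.indep w2 (-u2) fun x y => by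
      rw [hu, hw]
      linear_combination -(e 1 x * e 2 y - e 1 y * e 2 x) * hr1.symm
        + (e 2 x * e 0 y - e 2 y * e 0 x) * hr0.symm).2
    linarith
  exact one_ne_zero (h.indep 1 0 fun x y => by rw [hu, a0, a1, a2]; ring).1

theorem IsFrame.isListed_of_span₄ (h : IsFrame η ζ) (hc : ∀ x y z : L, ⁅⁅x, y⁆, z⁆ = 0)
    (e : Fin 4 → L →ₗ[ℝ] ℝ) (M N : Fin 4 → Fin 4 → ℝ)
    (h1 : ∀ x y, η ⁅x, y⁆ = ∑ i, ∑ j, M i j * (e i x * e j y))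
    (h2 : ∀ x y, ζ ⁅x, y⁆ = ∑ i, ∑ j, N i j * (e i x * e j y))
    (hd : ¬ Indep₄ (e 0) (e 1) (e 2) (e 3)) : IsListed L := by
  obtain ⟨r, hr, i, hi⟩ : ∃ r : Fin 4 → ℝ, (∀ x, ∑ j, r j * e j x = 0) ∧ ∃ i, r i ≠ 0 := by
    by_contra hcon
    push Not at hcon
    refine hd fun r s t u hru => ?_
    have := hcon ![r, s, t, u] fun x => by simpa [Fin.sum_univ_four] using hru x
    exact ⟨this 0, this 1, this 2, this 3⟩
  obtain ⟨e', C, hC⟩ : ∃ (e' : Fin 3 → L →ₗ[ℝ] ℝ) (C : Fin 4 → Fin 3 → ℝ),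
      ∀ j x, e j x = ∑ k, C j k * e' k x := by
    refine ⟨fun k => e (i.succAbove k), i.insertNth (fun k => -(r (i.succAbove k) / r i))
      (fun k => Pi.single k 1), ?_⟩
    rw [Fin.forall_iff_succAbove i]
    refine ⟨fun x => ?_, fun j x => ?_⟩
    · have := hr x
      rw [Fin.sum_univ_succAbove _ i] at this
      simp only [Fin.insertNth_apply_same, Fin.sum_univ_three] at this ⊢
      field_simp
      linear_combination this
    · simp [Fin.insertNth_apply_succAbove, Pi.single_apply]
  have key : ∀ (θ : L →ₗ[ℝ] ℝ) (M : Fin 4 → Fin 4 → ℝ),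
      (∀ x y, θ ⁅x, y⁆ = ∑ i, ∑ j, M i j * (e i x * e j y)) →
      ∀ x y, θ ⁅x, y⁆ = ∑ k, ∑ l, (∑ i, ∑ j, M i j * C i k * C j l) * (e' k x * e' l y) := by
    intro θ M hM x y
    rw [hM]
    simp only [hC, Fin.sum_univ_three, Fin.sum_univ_four]
    ring
  exact h.isListed_of_span₃ hc e' _ _ (key η M h1) (key ζ N h2)

/-- The independent case is `h(1) ⊕ h(1)`. If the four functionals are dependent, one can be
eliminated and three remain, which leads to `g_{5,2}`; the parabolic and elliptic cases are
parallel. -/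
theorem IsFrame.isListed_of_hyperbolic (h : IsFrame η ζ) (hc : ∀ x y z : L, ⁅⁅x, y⁆, z⁆ = 0)
    (a p b q : L →ₗ[ℝ] ℝ) (h1 : ∀ x y, η ⁅x, y⁆ = a x * p y - a y * p x)
    (h2 : ∀ x y, ζ ⁅x, y⁆ = b x * q y - b y * q x) : IsListed L := by
  by_cases hi : Indep₄ a p b q
  · exact h.isListed_of_h1_h1 a p b q h1 h2 hi hc
  · refine h.isListed_of_span₄ hc ![a, p, b, q]
      ![![0, 1, 0, 0], ![-1, 0, 0, 0], 0, 0] ![0, 0, ![0, 0, 0, 1], ![0, 0, -1, 0]]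
      (fun x y => ?_) (fun x y => ?_) hi
    · rw [h1]; simp [Fin.sum_univ_four]; ring
    · rw [h2]; simp [Fin.sum_univ_four]; ring

theorem IsFrame.isListed_of_parabolic (h : IsFrame η ζ) (hc : ∀ x y z : L, ⁅⁅x, y⁆, z⁆ = 0)
    (a p b q : L →ₗ[ℝ] ℝ)
    (h1 : ∀ x y, η ⁅x, y⁆ = (a x * p y - a y * p x) + (b x * q y - b y * q x))
    (h2 : ∀ x y, ζ ⁅x, y⁆ = a x * b y - a y * b x) : IsListed L := by
  by_cases hi : Indep₄ a p b q
  · exact h.isListed_of_g64 a p b q h1 h2 hi hc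
  · refine h.isListed_of_span₄ hc ![a, p, b, q]
      ![![0, 1, 0, 0], ![-1, 0, 0, 0], ![0, 0, 0, 1], ![0, 0, -1, 0]]
      ![![0, 0, 1, 0], 0, ![-1, 0, 0, 0], 0] (fun x y => ?_) (fun x y => ?_) hi
    · rw [h1]; simp [Fin.sum_univ_four]; ring
    · rw [h2]; simp [Fin.sum_univ_four]; ring

theorem IsFrame.isListed_of_elliptic (h : IsFrame η ζ) (hc : ∀ x y z : L, ⁅⁅x, y⁆, z⁆ = 0)
    (a p b q : L →ₗ[ℝ] ℝ)
    (h1 : ∀ x y, η ⁅x, y⁆ = (a x * p y - a y * p x) - (b x * q y - b y * q x))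
    (h2 : ∀ x y, ζ ⁅x, y⁆ = (a x * b y - a y * b x) + (p x * q y - p y * q x)) :
    IsListed L := by
  by_cases hi : Indep₄ a p b q
  · exact h.isListed_of_g65 a p b q h1 h2 hi hc
  · refine h.isListed_of_span₄ hc ![a, p, b, q]
      ![![0, 1, 0, 0], ![-1, 0, 0, 0], ![0, 0, 0, -1], ![0, 0, 1, 0]]
      ![![0, 0, 1, 0], ![0, 0, 0, 1], ![-1, 0, 0, 0], ![0, -1, 0, 0]]
      (fun x y => ?_) (fun x y => ?_) hi
    · rw [h1]; simp [Fin.sum_univ_four]; ring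
    · rw [h2]; simp [Fin.sum_univ_four]; ring

/-- Completing the square with `k = m / 2` gives `ζ = a ∧ P + b' ∧ q` and `η + kζ = b' ∧ P - (n -
k²) a ∧ q`. When the four functionals are independent, `η + kζ + tζ` is decomposable exactly for `t²
= k² - n`, so the sign of `n - k²` selects the normal form. -/
theorem IsFrame.isListed_of_monic_relation (h : IsFrame η ζ)
    (hc : ∀ x y z : L, ⁅⁅x, y⁆, z⁆ = 0) (a b p p' q : L →ₗ[ℝ] ℝ)
    (h1 : ∀ x y, η ⁅x, y⁆ = (a x * p' y - a y * p' x) + (b x * p y - b y * p x))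
    (h2 : ∀ x y, ζ ⁅x, y⁆ = (a x * p y - a y * p x) + (b x * q y - b y * q x))
    (m n c d : ℝ) (hr : ∀ x, p' x + m * p x + n * q x = c * a x + d * b x) : IsListed L := by
  set k := m / 2 with hk
  have hm : m = 2 * k := by rw [hk]; ring
  let b' := b - k • a
  let P := p + k • q - d • a
  have hb : ∀ x, b' x = b x - k * a x := fun x => rfl
  have hP : ∀ x, P x = p x + k * q x - d * a x := fun x => rfl
  have hp' : ∀ x, p' x = c * a x + d * b x - m * p x - n * q x := fun x => by
    linear_combination hr x
  rcases lt_trichotomy (n - k ^ 2) 0 with hn | hn | hn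
  · obtain ⟨r, hr0, hr⟩ : ∃ r : ℝ, 0 < r ∧ n = k ^ 2 - r ^ 2 :=
      ⟨√(k ^ 2 - n), Real.sqrt_pos.2 (by linarith), by rw [Real.sq_sqrt (by linarith)]; ring⟩
    refine (h.change 1 (k + r) 1 (k - r) (by intro h0; linarith)).isListed_of_hyperbolic hc
      (b' + r • a) (P + r • q) (b' - r • a) (P - r • q) (fun x y => ?_) (fun x y => ?_) <;>
    · simp only [LinearMap.add_apply, LinearMap.sub_apply, LinearMap.smul_apply, smul_eq_mul, h1,
        h2, hb, hP, hp', hr, hm]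
      ring
  · have hn' : n = k ^ 2 := by linarith
    refine (h.change 0 1 1 k (by norm_num)).isListed_of_parabolic hc
      b' q P (-a) (fun x y => ?_) (fun x y => ?_) <;>
    · simp only [LinearMap.add_apply, LinearMap.neg_apply, LinearMap.smul_apply, smul_eq_mul, h1,
        h2, hb, hP, hp', hn', hm]
      ring
  · obtain ⟨r, hr0, hr⟩ : ∃ r : ℝ, 0 < r ∧ n = k ^ 2 + r ^ 2 :=
      ⟨√(n - k ^ 2), Real.sqrt_pos.2 (by linarith), by rw [Real.sq_sqrt (by linarith)]; ring⟩
    refine (h.change 1 k 0 r (by simpa using hr0.ne')).isListed_of_elliptic hc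
      b' P (r • q) (-(r • a)) (fun x y => ?_) (fun x y => ?_) <;>
    · simp only [LinearMap.add_apply, LinearMap.neg_apply, LinearMap.smul_apply, smul_eq_mul, h1,
        h2, hb, hP, hp', hr, hm]
      ring

/-- The classification of the pencils given by a symmetric matrix of functionals whose entries
satisfy a linear relation modulo `a` and `b`. -/
theorem IsFrame.isListed_of_relation (h : IsFrame η ζ)
    (hc : ∀ x y z : L, ⁅⁅x, y⁆, z⁆ = 0) (a b p p' q : L →ₗ[ℝ] ℝ)
    (h1 : ∀ x y, η ⁅x, y⁆ = (a x * p' y - a y * p' x) + (b x * p y - b y * p x))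
    (h2 : ∀ x y, ζ ⁅x, y⁆ = (a x * p y - a y * p x) + (b x * q y - b y * q x))
    (l m n c d : ℝ) (hr : ∀ x, l * p' x + m * p x + n * q x = c * a x + d * b x)
    (hl : l ≠ 0 ∨ m ≠ 0 ∨ n ≠ 0) : IsListed L := by
  by_cases hl0 : l = 0
  -- For `l = n = 0` the relation expresses `p` through `a`, `b`, and both forms become
  -- decomposable. For `n ≠ 0`, exchanging `η` with `ζ` swaps `a` with `b` and `p'` with `q`, which
  -- makes the relation monic.
  · by_cases hn0 : n = 0
    · have hm : m ≠ 0 := by tauto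
      have hp : ∀ x, p x = c / m * a x + d / m * b x := fun x => by
        have := hr x
        rw [hl0, hn0] at this
        field_simp
        linear_combination this
      refine h.isListed_of_hyperbolic hc a (p' - (c / m) • b) b (q - (d / m) • a)
        (fun x y => ?_) (fun x y => ?_)
      · rw [h1, hp, hp]; simp only [LinearMap.sub_apply, LinearMap.smul_apply, smul_eq_mul]; ring
      · rw [h2, hp, hp]; simp only [LinearMap.sub_apply, LinearMap.smul_apply, smul_eq_mul]; ring
    · refine h.swap.isListed_of_monic_relation hc b a p q p' (fun x y => ?_) (fun x y => ?_)
        (m / n) (l / n) (d / n) (c / n) fun x => ?_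
      · rw [h2]; ring
      · rw [h1]; ring
      · field_simp
        linear_combination hr x
  · refine h.isListed_of_monic_relation hc a b p p' q h1 h2 (m / l) (n / l) (c / l) (d / l)
      fun x => ?_
    field_simp
    linear_combination hr x

end PencilClassification

/-! ### The lower central series, bases of the derived algebra, and cocycle identities -/

section AdmissibleTwoStep

variable {L : Type*} [LieRing L] [LieAlgebra ℝ L]

/-- A basis `Y, Z` of the derived algebra together with coordinate functionals. -/
structure IsDerivedBasis (Y Z : L) (η ζ : L →ₗ[ℝ] ℝ) : Prop where
  mem_left : Y ∈ LieModule.lowerCentralSeries ℝ L L 1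
  mem_right : Z ∈ LieModule.lowerCentralSeries ℝ L L 1
  fst_left : η Y = 1
  snd_left : ζ Y = 0
  fst_right : η Z = 0
  snd_right : ζ Z = 1
  eq_add : ∀ u ∈ LieModule.lowerCentralSeries ℝ L L 1, u = η u • Y + ζ u • Z

theorem lie_mem_lcs_one (x y : L) : ⁅x, y⁆ ∈ LieModule.lowerCentralSeries ℝ L L 1 :=
  LieSubmodule.lie_mem_lie (LieSubmodule.mem_top x) (LieSubmodule.mem_top y)

theorem lcs_succ_induction {V : Type*} [AddCommGroup V] [Module ℝ V] (k : ℕ) (θ : L →ₗ[ℝ] V)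
    (h : ∀ x : L, ∀ y ∈ LieModule.lowerCentralSeries ℝ L L k, θ ⁅x, y⁆ = 0) :
    ∀ u ∈ LieModule.lowerCentralSeries ℝ L L (k + 1), θ u = 0 := by
  intro u hu
  rw [LieModule.lowerCentralSeries_succ, ← LieSubmodule.mem_toSubmodule,
    LieSubmodule.lieIdeal_oper_eq_linear_span'] at hu
  refine (Submodule.span_le (p := LinearMap.ker θ)).2 ?_ hu
  rintro _ ⟨x, -, y, hy, rfl⟩
  exact h x y hy

theorem lcs_one_induction {V : Type*} [AddCommGroup V] [Module ℝ V] (θ : L →ₗ[ℝ] V)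
    (h : ∀ x y : L, θ ⁅x, y⁆ = 0) :
    ∀ u ∈ LieModule.lowerCentralSeries ℝ L L 1, θ u = 0 :=
  lcs_succ_induction 0 θ fun x y _ => h x y

theorem lcs_eq_of_eq_succ {k : ℕ} (h : LieModule.lowerCentralSeries ℝ L L (k + 1)
    = LieModule.lowerCentralSeries ℝ L L k) (n : ℕ) :
    LieModule.lowerCentralSeries ℝ L L (k + n) = LieModule.lowerCentralSeries ℝ L L k := by
  induction n with
  | zero => rfl
  | succ n ih =>
    rw [← add_assoc, LieModule.lowerCentralSeries_succ, ih, ← LieModule.lowerCentralSeries_succ, h]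

theorem lcs_succ_lt [LieRing.IsNilpotent L] {k : ℕ}
    (h : LieModule.lowerCentralSeries ℝ L L k ≠ ⊥) :
    LieModule.lowerCentralSeries ℝ L L (k + 1) < LieModule.lowerCentralSeries ℝ L L k := by
  refine lt_of_le_of_ne (LieModule.antitone_lowerCentralSeries ℝ L L (Nat.le_succ k)) fun heq => ?_
  obtain ⟨n, hn⟩ := LieModule.IsNilpotent.nilpotent ℝ L L
  apply h
  rw [← lcs_eq_of_eq_succ heq n, eq_bot_iff, ← hn]
  exact LieModule.antitone_lowerCentralSeries ℝ L L (Nat.le_add_left n k)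

theorem exists_isDerivedBasis
    (hd : Module.finrank ℝ (LieModule.lowerCentralSeries ℝ L L 1) = 2) (Y : L)
    (hY : Y ∈ LieModule.lowerCentralSeries ℝ L L 1) (hY0 : Y ≠ 0) :
    ∃ Z η ζ, IsDerivedBasis Y Z η ζ := by
  set W := (LieModule.lowerCentralSeries ℝ L L 1).toSubmodule
  have hd : Module.finrank ℝ W = 2 := hd
  let y : W := ⟨Y, hY⟩
  have hy : y ≠ 0 := fun h => hY0 (congrArg Subtype.val h)
  obtain ⟨z, hz⟩ : ∃ z : W, LinearIndependent ℝ ![y, z] := by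
    by_contra hcon
    push Not at hcon
    have : Module.finrank ℝ W ≤ 1 := finrank_le_one y fun w => by
      have := hcon w
      rw [LinearIndependent.pair_iff' hy] at this
      push Not at this
      exact this
    omega
  let b := basisOfLinearIndependentOfCardEqFinrank hz (by simp [hd])
  have hb0 : b 0 = y := by simp [b]
  have hb1 : b 1 = z := by simp [b]
  obtain ⟨η, hη⟩ := LinearMap.exists_extend (b.coord 0)
  obtain ⟨ζ, hζ⟩ := LinearMap.exists_extend (b.coord 1)
  have hη' : ∀ w : W, η w = b.coord 0 w := fun w => by rw [← hη]; rfl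
  have hζ' : ∀ w : W, ζ w = b.coord 1 w := fun w => by rw [← hζ]; rfl
  have e1 := hη' y
  have e2 := hζ' y
  have e3 := hη' z
  have e4 := hζ' z
  rw [← hb0] at e1 e2
  rw [← hb1] at e3 e4
  simp only [Module.Basis.coord_apply, Module.Basis.repr_self] at e1 e2 e3 e4
  rw [hb0] at e1 e2
  rw [hb1] at e3 e4
  refine ⟨z, η, ζ, hY, z.2, by simpa using e1, by simpa using e2, by simpa using e3,
    by simpa using e4, fun u hu => ?_⟩
  have h1 := b.sum_repr ⟨u, hu⟩
  rw [Fin.sum_univ_two, hb0, hb1] at h1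
  have h2 := congrArg Subtype.val h1
  rw [hη' ⟨u, hu⟩, hζ' ⟨u, hu⟩]
  exact h2.symm

theorem IsDerivedBasis.isFrame {Y Z : L} {η ζ : L →ₗ[ℝ] ℝ} (h : IsDerivedBasis Y Z η ζ) :
    IsFrame η ζ := by
  refine ⟨fun c d hcd => ?_, fun u hu h1 h2 => by rw [h.eq_add u hu, h1, h2]; simp⟩
  have key := lcs_one_induction (c • η + d • ζ) hcd
  have e1 := key Y h.mem_left
  have e2 := key Z h.mem_right
  simp only [LinearMap.add_apply, LinearMap.smul_apply, smul_eq_mul, h.fst_left, h.snd_left,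
    h.fst_right, h.snd_right] at e1 e2
  exact ⟨by linarith, by linarith⟩

section Cocycle

variable {A : Type*} [AddCommGroup A] [Module ℝ A] [LieRingModule L A] [LieModule ℝ L A]
  {B : LinearMap.BilinForm ℝ A}

/-- For invariant values of `α` the module terms of `dα` drop out. -/
theorem QuadCocycle.cyclic (c : QuadCocycle L B)
    (hinv : ∀ x y : L, c.α x y ∈ LieModule.maxTrivSubmodule ℝ L A) (x y z : L) :
    c.α ⁅x, y⁆ z + c.α ⁅y, z⁆ x + c.α ⁅z, x⁆ y = 0 := by
  have h : d₂₃ ℝ L A c.α x y z = 0 := by rw [c.d_α]; rfl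
  rw [d₂₃_apply, (LieModule.mem_maxTrivSubmodule ℝ L A _).1 (hinv y z) x,
    (LieModule.mem_maxTrivSubmodule ℝ L A _).1 (hinv x z) y,
    (LieModule.mem_maxTrivSubmodule ℝ L A _).1 (hinv x y) z, ← lie_skew x z, map_neg,
    LinearMap.neg_apply] at h
  rw [← neg_eq_zero, ← h]
  abel

theorem QuadCocycle.d_γ_apply (c : QuadCocycle L B) (hB : B.IsSymm) (w x y z : L) :
    dThree c.γ w x y z =
      B (c.α w x) (c.α y z) - B (c.α w y) (c.α x z) + B (c.α w z) (c.α x y) := by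
  rw [c.d_γ, wedge₂₂, hB.eq (c.α x y), hB.eq (c.α x z), hB.eq (c.α y z)]
  ring

theorem alternating_swap (γ : L [⋀^Fin 3]→ₗ[ℝ] ℝ) (x y z : L) :
    γ ![y, x, z] = -γ ![x, y, z] := by
  rw [← γ.map_swap _ (show (0 : Fin 3) ≠ 1 by decide)]
  congr 1
  funext i
  fin_cases i <;> rfl

theorem alternating_swap_right (γ : L [⋀^Fin 3]→ₗ[ℝ] ℝ) (x y z : L) :
    γ ![x, z, y] = -γ ![x, y, z] := by
  rw [← γ.map_swap _ (show (1 : Fin 3) ≠ 2 by decide)]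
  congr 1
  funext i
  fin_cases i <;> rfl

theorem alternating_rotate (γ : L [⋀^Fin 3]→ₗ[ℝ] ℝ) (x y z : L) :
    γ ![y, z, x] = γ ![x, y, z] := by
  rw [alternating_swap_right, alternating_swap, neg_neg]

theorem alternating_self_left (γ : L [⋀^Fin 3]→ₗ[ℝ] ℝ) (x z : L) : γ ![x, x, z] = 0 := by
  have := alternating_swap γ x x z
  linarith

theorem alternating_zero_left (γ : L [⋀^Fin 3]→ₗ[ℝ] ℝ) (y z : L) : γ ![0, y, z] = 0 :=
  γ.map_coord_zero 0 rfl

theorem alternating_add_smul (γ : L [⋀^Fin 3]→ₗ[ℝ] ℝ) (r s : ℝ) (u v y z : L) :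
    γ ![r • u + s • v, y, z] = r * γ ![u, y, z] + s * γ ![v, y, z] := by
  rw [AlternatingMap.map_vecCons_add, AlternatingMap.map_vecCons_smul,
    AlternatingMap.map_vecCons_smul, smul_eq_mul, smul_eq_mul]

/-- An isotropic vector that spans the image of `l ⊗ l^{k+1}` and is attained on commuting
arguments vanishes. -/
theorem ConditionB.eq_zero_of_isotropic {c : QuadCocycle L B} {k : ℕ} (h : ConditionB c k)
    (s : A) (hs : B s s = 0)
    (hspan : ∀ x, ∀ y ∈ LieModule.lowerCentralSeries ℝ L L k, ∃ r : ℝ, c.α x y = r • s)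
    (hmem : ∃ x, ∃ y ∈ LieModule.lowerCentralSeries ℝ L L k, ⁅x, y⁆ = 0 ∧ c.α x y = s) :
    s = 0 := by
  obtain ⟨x, y, hy, hxy, hα⟩ := hmem
  have hsub : LinearMap.range (cochainMap c.α k) ≤ Submodule.span ℝ {s} := by
    rintro _ ⟨t, rfl⟩
    induction t using TensorProduct.induction_on with
    | zero => rw [map_zero]; exact zero_mem _
    | add t t' ht ht' => rw [map_add]; exact add_mem ht ht'
    | tmul a b =>
      obtain ⟨r, hr⟩ := hspan a b b.2
      exact Submodule.mem_span_singleton.2 ⟨r, hr.symm⟩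
  have hsm : s ∈ (LinearMap.ker (bracketMap L k)).map (cochainMap c.α k) :=
    ⟨x ⊗ₜ ⟨y, hy⟩, hxy, hα⟩
  -- The subspace tested by `(B_k)` contains `s` and lies in the line through `s`, on which the form
  -- vanishes.
  refine congrArg Subtype.val (h.1 ⟨s, hsm⟩ fun ⟨v, hv⟩ => ?_)
  obtain ⟨r, rfl⟩ := Submodule.mem_span_singleton.1 (hsub (LinearMap.map_le_range hv))
  change B s (r • s) = 0
  rw [map_smul, hs, smul_zero]

end Cocycle

end AdmissibleTwoStep

/-! ### Factoring the two structure forms by means of a cocycle -/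

section TwoFormFactorization

variable {L : Type*} [LieRing L] [LieAlgebra ℝ L]

/-- A 2-form `θ ⁅x, y⁆` that vanishes on the common kernel of `a` and `b` lies in the ideal
generated by `a` and `b`. -/
theorem exists_eq_wedge_add_wedge (θ a b : L →ₗ[ℝ] ℝ) {x₁ x₂ : L} (a1 : a x₁ = 1) (b1 : b x₁ = 0)
    (a2 : a x₂ = 0) (b2 : b x₂ = 1)
    (h : ∀ x y, a x = 0 → b x = 0 → a y = 0 → b y = 0 → θ ⁅x, y⁆ = 0) :
    ∃ p q : L →ₗ[ℝ] ℝ,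
      ∀ x y : L, θ ⁅x, y⁆ = (a x * p y - a y * p x) + (b x * q y - b y * q x) := by
  have hs : ∀ x y : L, θ ⁅x, y⁆ = -θ ⁅y, x⁆ := fun x y => by rw [← lie_skew, map_neg]
  -- Without the correction by `b`, the component `θ ⁅x₁, x₂⁆` of `a ∧ b` would be counted in both
  -- `p` and `q`.
  let p : L →ₗ[ℝ] ℝ := θ ∘ₗ (LieModule.toEnd ℝ L L x₁) - (θ ⁅x₁, x₂⁆) • b
  let q : L →ₗ[ℝ] ℝ := θ ∘ₗ (LieModule.toEnd ℝ L L x₂)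
  have hp : ∀ x, p x = θ ⁅x₁, x⁆ - θ ⁅x₁, x₂⁆ * b x := fun x => rfl
  have hq : ∀ x, q x = θ ⁅x₂, x⁆ := fun x => rfl
  refine ⟨p, q, fun x y => ?_⟩
  have := h (x - a x • x₁ - b x • x₂) (y - a y • x₁ - b y • x₂) (by simp [a1, a2])
    (by simp [b1, b2]) (by simp [a1, a2]) (by simp [b1, b2])
  simp only [sub_lie, lie_sub, smul_lie, lie_smul, map_sub, map_smul, lie_self, map_zero,
    smul_eq_mul, hs x x₁, hs x x₂, hs x₂ x₁] at this
  rw [hp, hp, hq, hq]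
  linear_combination this

variable {η ζ : L →ₗ[ℝ] ℝ} [FiniteDimensional ℝ L]
  {A : Type*} [AddCommGroup A] [Module ℝ A] {B : LinearMap.BilinForm ℝ A}

/-- Pairing the cyclic identity with `A₀` gives `a ∧ η + b ∧ ζ = 0`. This forces a symmetric matrix
of functionals `p', p, q`. If they are independent modulo `a`, `b`, the cyclic identity leaves `C`,
`D` only an isotropic direction, contradicting `hiso`; otherwise their relation decides the pencil.
-/
theorem IsFrame.isListed_of_indep_pair (h : IsFrame η ζ) (hc : ∀ x y z : L, ⁅⁅x, y⁆, z⁆ = 0)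
    (C D : L →ₗ[ℝ] A)
    (hcyc : ∀ x y z : L, (η ⁅x, y⁆ • C z + ζ ⁅x, y⁆ • D z) + (η ⁅y, z⁆ • C x + ζ ⁅y, z⁆ • D x)
      + (η ⁅z, x⁆ • C y + ζ ⁅z, x⁆ • D y) = 0)
    (hsymm : ∀ x y, B (C x) (D y) = B (D x) (C y))
    (hiso : ∀ s : A, B s s = 0 → (∃ x, C x = s) →
      (∀ x, (∃ r : ℝ, C x = r • s) ∧ ∃ r : ℝ, D x = r • s) → s = 0)
    (A₀ : A) (hind : ∀ r s : ℝ, (∀ x, r * B A₀ (C x) + s * B A₀ (D x) = 0) → r = 0 ∧ s = 0) :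
    IsListed L := by
  have hs : ∀ (θ : L →ₗ[ℝ] ℝ) (x y : L), θ ⁅x, y⁆ = -θ ⁅y, x⁆ := fun θ x y => by
    rw [← lie_skew, map_neg]
  let a : L →ₗ[ℝ] ℝ := B A₀ ∘ₗ C
  let b : L →ₗ[ℝ] ℝ := B A₀ ∘ₗ D
  have hind : ∀ r s : ℝ, (∀ x, r * a x + s * b x = 0) → r = 0 ∧ s = 0 := hind
  have hab : ∀ x y z : L, (η ⁅x, y⁆ * a z + ζ ⁅x, y⁆ * b z) + (η ⁅y, z⁆ * a x + ζ ⁅y, z⁆ * b x)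
      + (η ⁅z, x⁆ * a y + ζ ⁅z, x⁆ * b y) = 0 := fun x y z => by
    have := congrArg (B A₀) (hcyc x y z)
    simp only [map_add, map_smul, smul_eq_mul, map_zero] at this
    exact this
  have hdual : ∀ v : Fin 2 → ℝ, ∃ x, ∀ i, (![a, b] : Fin 2 → L →ₗ[ℝ] ℝ) i x = v i :=
    exists_apply_eq_of_linearIndependent _ fun c hcx => by
      obtain ⟨h0, h1⟩ := hind (c 0) (c 1) fun x => by
        simpa [Fin.sum_univ_two] using hcx x
      funext i; fin_cases i <;> assumption
  obtain ⟨x₁, hx₁⟩ := hdual ![1, 0]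
  obtain ⟨x₂, hx₂⟩ := hdual ![0, 1]
  have a1 : a x₁ = 1 := hx₁ 0
  have b1 : b x₁ = 0 := hx₁ 1
  have a2 : a x₂ = 0 := hx₂ 0
  have b2 : b x₂ = 1 := hx₂ 1
  obtain ⟨p, q, h2⟩ := exists_eq_wedge_add_wedge ζ a b a1 b1 a2 b2 fun x y ax bx ay bY => by
    have := hab x₂ x y
    rw [ax, bx, ay, bY, a2, b2] at this
    linarith
  -- Contracting `a ∧ η + b ∧ ζ = 0` with `x₁` solves for `η`. The term in `b` is arranged so that
  -- the `b`-coefficient of `η` is the same `p` as the `a`-coefficient of `ζ`.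
  let p' : L →ₗ[ℝ] ℝ := η ∘ₗ (LieModule.toEnd ℝ L L x₁) + p x₁ • b
  have hp' : ∀ x, p' x = η ⁅x₁, x⁆ + p x₁ * b x := fun x => rfl
  have h1 : ∀ x y : L, η ⁅x, y⁆ = (a x * p' y - a y * p' x) + (b x * p y - b y * p x) :=
    fun x y => by
      have := hab x₁ x y
      rw [h2 x₁ x, h2 y x₁, h2 x y, hs η y x₁, a1, b1] at this
      rw [hp', hp']
      linear_combination this
  by_cases hrel : ∀ c : Fin 5 → ℝ,
      (∀ x, ∑ i, c i * (![a, b, p, p', q] : Fin 5 → L →ₗ[ℝ] ℝ) i x = 0) → c = 0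
  · exfalso
    have key := exists_apply_eq_of_linearIndependent _ hrel
    obtain ⟨xa, ha⟩ := key ![1, 0, 0, 0, 0]
    obtain ⟨xb, hb⟩ := key ![0, 1, 0, 0, 0]
    obtain ⟨xp, hp⟩ := key ![0, 0, 1, 0, 0]
    obtain ⟨xp', hp'⟩ := key ![0, 0, 0, 1, 0]
    obtain ⟨xq, hq⟩ := key ![0, 0, 0, 0, 1]
    simp only [Fin.forall_fin_succ, Matrix.cons_val_zero, Matrix.cons_val_succ,
      IsEmpty.forall_iff, and_true] at ha hb hp hp' hq
    obtain ⟨ha1, ha2, ha3, ha4, ha5⟩ := ha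
    obtain ⟨hb1, hb2, hb3, hb4, hb5⟩ := hb
    obtain ⟨hp1, hp2, hp3, hp4, hp5⟩ := hp
    obtain ⟨hp'1, hp'2, hp'3, hp'4, hp'5⟩ := hp'
    obtain ⟨hq1, hq2, hq3, hq4, hq5⟩ := hq
    -- At a pair of vectors of the dual system one bracket coefficient is `1` and the other `0`, so
    -- the cyclic identity expresses `C` or `D` through the five functionals. Comparing the four
    -- expressions at dual vectors leaves `C = a • s` and `D = b • s` with `s = C xa`.
    have E1 : ∀ x, C x = a x • C xa + p' x • C xp' + p x • D xp' := fun x => by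
      have := hcyc xa xp' x
      rw [h1, h2, h1, h2, h1, h2, ha1, ha2, ha3, ha4, ha5, hp'1, hp'2, hp'3, hp'4, hp'5] at this
      rw [← sub_eq_zero, ← this]
      module
    have E2 : ∀ x, D x = b x • D xb + q x • D xq + p x • C xq := fun x => by
      have := hcyc xb xq x
      rw [h1, h2, h1, h2, h1, h2, hb1, hb2, hb3, hb4, hb5, hq1, hq2, hq3, hq4, hq5] at this
      rw [← sub_eq_zero, ← this]
      module
    have E3 : ∀ x, D x = b x • C xa + a x • D xa + p' x • C xp + p x • D xp := fun x => by
      have := hcyc xa xp x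
      rw [h1, h2, h1, h2, h1, h2, ha1, ha2, ha3, ha4, ha5, hp1, hp2, hp3, hp4, hp5] at this
      rw [← sub_eq_zero, ← this]
      module
    have E4 : ∀ x, C x = b x • C xb + a x • D xb + p x • C xp + q x • D xp := fun x => by
      have := hcyc xb xp x
      rw [h1, h2, h1, h2, h1, h2, hb1, hb2, hb3, hb4, hb5, hp1, hp2, hp3, hp4, hp5] at this
      rw [← sub_eq_zero, ← this]
      module
    have c1 : C xp' = 0 := by
      have := E4 xp'
      rw [hp'1, hp'2, hp'3, hp'5] at this
      simpa using this
    have c2 : D xp' = 0 := by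
      have := E2 xp'
      rw [hp'2, hp'3, hp'5] at this
      simpa using this
    have c3 : C xq = 0 := by
      have := E1 xq
      rw [hq1, hq3, hq4] at this
      simpa using this
    have c4 : D xq = 0 := by
      have := E3 xq
      rw [hq1, hq2, hq3, hq4] at this
      simpa using this
    have c5 : C xa = D xb := by
      have := E4 xa
      rw [ha1, ha2, ha3, ha5] at this
      simpa using this
    have hC : ∀ x, C x = a x • C xa := fun x => by rw [E1 x, c1, c2]; simp
    have hD : ∀ x, D x = b x • C xa := fun x => by rw [E2 x, c3, c4, ← c5]; simp
    -- Symmetry at `xa`, `xb` reads `⟨s, s⟩ = ⟨D xa, C xb⟩`, and the right side is zero.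
    have hzero : C xa = 0 := by
      refine hiso (C xa) ?_ ⟨xa, rfl⟩ fun x => ⟨⟨_, hC x⟩, ⟨_, hD x⟩⟩
      have := hsymm xa xb
      rw [← c5, hD xa, hC xb, ha2, hb1] at this
      simpa using this
    have : a xa = 0 := by change B A₀ (C xa) = 0; rw [hzero, map_zero]
    rw [this] at ha1
    exact zero_ne_one ha1
  · push Not at hrel
    obtain ⟨c, hcx, hc0⟩ := hrel
    simp only [Fin.sum_univ_five, Matrix.cons_val] at hcx
    refine h.isListed_of_relation hc a b p p' q h1 h2 (c 3) (c 2) (c 4) (-c 0) (-c 1)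
      (fun x => by linear_combination hcx x) ?_
    by_contra hcon
    push Not at hcon
    obtain ⟨z3, z2, z4⟩ := hcon
    obtain ⟨z0, z1⟩ := hind (c 0) (c 1) fun x => by
      have := hcx x
      rw [z3, z2, z4] at this
      linear_combination this
    apply hc0
    funext i
    fin_cases i <;> assumption

/-- The pairs `(⟨A₀, C⟩, ⟨A₀, D⟩)` form a linear space of elements of rank at most one. Since no
fixed combination of `C` and `D` vanishes, all these functionals must be proportional to one `e`,
and `e` is a common factor of both forms. -/
theorem IsFrame.isListed_of_dependent_pairs (h : IsFrame η ζ)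
    (hc : ∀ x y z : L, ⁅⁅x, y⁆, z⁆ = 0) (hB : B.Nondegenerate) (C D : L →ₗ[ℝ] A)
    (hcyc : ∀ x y z : L, (η ⁅x, y⁆ • C z + ζ ⁅x, y⁆ • D z) + (η ⁅y, z⁆ • C x + ζ ⁅y, z⁆ • D x)
      + (η ⁅z, x⁆ • C y + ζ ⁅z, x⁆ • D y) = 0)
    (hne : ∀ r s : ℝ, (∀ x, r • C x + s • D x = 0) → r = 0 ∧ s = 0)
    (hdep : ∀ A₀ : A, ∃ r s : ℝ, (r ≠ 0 ∨ s ≠ 0) ∧ ∀ x, r * B A₀ (C x) + s * B A₀ (D x) = 0) :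
    IsListed L := by
  have hab : ∀ (A₀ : A) (x y z : L), (η ⁅x, y⁆ * B A₀ (C z) + ζ ⁅x, y⁆ * B A₀ (D z))
      + (η ⁅y, z⁆ * B A₀ (C x) + ζ ⁅y, z⁆ * B A₀ (D x))
      + (η ⁅z, x⁆ * B A₀ (C y) + ζ ⁅z, x⁆ * B A₀ (D y)) = 0 := fun A₀ x y z => by
    have := congrArg (B A₀) (hcyc x y z)
    simpa only [map_add, map_smul, smul_eq_mul, map_zero] using this
  have hex : ∀ r s : ℝ, (r ≠ 0 ∨ s ≠ 0) → ∃ (A₀ : A) (x : L), B A₀ (r • C x + s • D x) ≠ 0 := by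
    intro r s hrs
    by_contra hcon
    push Not at hcon
    obtain ⟨h1, h2⟩ := hne r s fun x => hB.2 _ fun A₀ => hcon A₀ x
    tauto
  obtain ⟨A₁, x₁, hx₁⟩ := hex 1 0 (by simp)
  rw [one_smul, zero_smul, add_zero] at hx₁
  obtain ⟨r₁, s₁, hrs₁, h1⟩ := hdep A₁
  have hs₁ : s₁ ≠ 0 := fun h0 => by
    have := h1 x₁
    rw [h0, zero_mul, add_zero] at this
    have := (mul_eq_zero.1 this).resolve_right hx₁
    tauto
  obtain ⟨k, hk⟩ : ∃ k : ℝ, ∀ x, B A₁ (D x) = k * B A₁ (C x) :=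
    ⟨-r₁ / s₁, fun x => by field_simp; linear_combination h1 x⟩
  obtain ⟨A₂, x₂, hx₂⟩ := hex (-k) 1 (by simp)
  let e : L →ₗ[ℝ] ℝ := B A₂ ∘ₗ (D - k • C)
  have he : ∀ x, e x = B A₂ (D x) - k * B A₂ (C x) := fun x => by
    change B A₂ (D x - k • C x) = _
    rw [map_sub, map_smul, smul_eq_mul]
  have hex₂ : e x₂ ≠ 0 := by
    rw [he]
    rw [map_add, map_smul, map_smul] at hx₂
    intro h0
    apply hx₂
    simp only [smul_eq_mul]
    linear_combination h0
  have mult : ∀ A' : A, (∀ x, B A' (D x) - k * B A' (C x) = e x) →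
      ∃ m : ℝ, ∀ x, B A' (C x) = m * e x := fun A' hA' => by
    obtain ⟨r, s, hrs, hx⟩ := hdep A'
    have hne : r + s * k ≠ 0 := fun h0 => by
      have h3 : s * e x₂ = 0 := by
        rw [← hA']; linear_combination hx x₂ - B A' (C x₂) * h0
      have hs : s = 0 := (mul_eq_zero.1 h3).resolve_right hex₂
      rw [hs] at h0
      simp at h0
      tauto
    refine ⟨-s / (r + s * k), fun x => ?_⟩
    rw [← hA']
    field_simp
    linear_combination hx x
  obtain ⟨m₂, hm₂⟩ := mult A₂ fun x => (he x).symm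
  -- Pairing with `A₁` kills `D - k • C`, so `A₂` and `A₁ + A₂` define the same `e`. Subtracting
  -- their conclusions makes `⟨A₁, C⟩` a multiple of `e`.
  obtain ⟨m₃, hm₃⟩ := mult (A₁ + A₂) fun x => by
    rw [map_add, LinearMap.add_apply, LinearMap.add_apply, hk, he]; ring
  have hm₁ : ∀ x, B A₁ (C x) = (m₃ - m₂) * e x := fun x => by
    have := hm₃ x
    rw [map_add, LinearMap.add_apply, hm₂] at this
    linear_combination this
  have hm0 : m₃ - m₂ ≠ 0 := fun h0 => hx₁ (by rw [hm₁, h0, zero_mul])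
  have f1 : ∀ x y z : L, e x * (η + k • ζ) ⁅y, z⁆ + e y * (η + k • ζ) ⁅z, x⁆
      + e z * (η + k • ζ) ⁅x, y⁆ = 0 := fun x y z => by
    have := hab A₁ x y z
    simp only [hk, hm₁] at this
    simp only [LinearMap.add_apply, LinearMap.smul_apply, smul_eq_mul]
    refine (mul_eq_zero.1 (?_ : (m₃ - m₂) * _ = 0)).resolve_left hm0
    linear_combination this
  have f2 : ∀ x y z : L, e x * ζ ⁅y, z⁆ + e y * ζ ⁅z, x⁆ + e z * ζ ⁅x, y⁆ = 0 := fun x y z => by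
    have := hab A₂ x y z
    have hD : ∀ x, B A₂ (D x) = e x + k * B A₂ (C x) := fun x => by rw [he]; ring
    simp only [hD, hm₂] at this
    have h3 := f1 x y z
    simp only [LinearMap.add_apply, LinearMap.smul_apply, smul_eq_mul] at h3
    linear_combination this - m₂ * h3
  refine h.isListed_of_common_factor hc e x₂ hex₂ (fun x y z => ?_) f2
  have h3 := f1 x y z
  simp only [LinearMap.add_apply, LinearMap.smul_apply, smul_eq_mul] at h3
  linear_combination h3 - k * f2 x y z

/-- The case `α(Y,·) = 0`, with `g = γ(·, Y, Z)`. If `D = 0`, then `g` is a common factor. Otherwise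
`ζ` is divisible by `g` and by some `f = ⟨A₁, D⟩` independent of `g`, so it is a multiple of `f ∧
g`; `η` lies in the ideal generated by `f` and `g`, which is the parabolic form. -/
theorem IsFrame.isListed_of_left_zero (h : IsFrame η ζ)
    (hc : ∀ x y z : L, ⁅⁅x, y⁆, z⁆ = 0) (hB : B.Nondegenerate) (D : L →ₗ[ℝ] A)
    (hcyc : ∀ x y z : L, ζ ⁅x, y⁆ • D z + ζ ⁅y, z⁆ • D x + ζ ⁅z, x⁆ • D y = 0)
    (g : L →ₗ[ℝ] ℝ) (hg : ¬ ∃ A₀ : A, ∀ x, g x = B A₀ (D x))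
    (hgζ : ∀ x y z : L, g x * ζ ⁅y, z⁆ + g y * ζ ⁅z, x⁆ + g z * ζ ⁅x, y⁆ = 0)
    (α : L → L → A)
    (hgη : ∀ x y z : L, g x * η ⁅y, z⁆ + g y * η ⁅z, x⁆ + g z * η ⁅x, y⁆
      = -(B (α x y) (D z) - B (α x z) (D y) + B (α y z) (D x))) : IsListed L := by
  by_cases hD : ∀ x, D x = 0
  · obtain ⟨x₀, hx₀⟩ : ∃ x, g x ≠ 0 := by
      by_contra hcon
      push Not at hcon
      exact hg ⟨0, fun x => by rw [hcon]; simp⟩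
    exact h.isListed_of_common_factor hc g x₀ hx₀
      (fun x y z => by rw [hgη, hD, hD, hD]; simp) hgζ
  push Not at hD
  obtain ⟨y₀, hy₀⟩ := hD
  obtain ⟨A₁, hA₁⟩ : ∃ A₁, B A₁ (D y₀) ≠ 0 := by
    by_contra hcon
    push Not at hcon
    exact hy₀ (hB.2 _ hcon)
  let f : L →ₗ[ℝ] ℝ := B A₁ ∘ₗ D
  have hf : ∀ x, f x = B A₁ (D x) := fun x => rfl
  have hcA : ∀ (A' : A) (x y z : L), ζ ⁅x, y⁆ * B A' (D z) + ζ ⁅y, z⁆ * B A' (D x)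
      + ζ ⁅z, x⁆ * B A' (D y) = 0 := fun A' x y z => by
    have := congrArg (B A') (hcyc x y z)
    simpa only [map_add, map_smul, smul_eq_mul, map_zero] using this
  have hind : ∀ r s : ℝ, (∀ x, r * f x + s * g x = 0) → r = 0 ∧ s = 0 := by
    intro r s hrs
    have hs : s = 0 := by
      by_contra hs
      refine hg ⟨(-r / s) • A₁, fun x => ?_⟩
      rw [map_smul, LinearMap.smul_apply, smul_eq_mul, ← hf]
      field_simp
      linear_combination hrs x
    subst hs
    have := hrs y₀
    rw [zero_mul, add_zero] at this
    exact ⟨(mul_eq_zero.1 this).resolve_right hA₁, rfl⟩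
  have hdual : ∀ v : Fin 2 → ℝ, ∃ x, ∀ i, (![f, g] : Fin 2 → L →ₗ[ℝ] ℝ) i x = v i :=
    exists_apply_eq_of_linearIndependent _ fun c hcx => by
      obtain ⟨h0, h1⟩ := hind (c 0) (c 1) fun x => by
        simpa [Fin.sum_univ_two] using hcx x
      funext i; fin_cases i <;> assumption
  obtain ⟨x₁, hx₁⟩ := hdual ![1, 0]
  obtain ⟨x₂, hx₂⟩ := hdual ![0, 1]
  have f1 : f x₁ = 1 := hx₁ 0
  have g1 : g x₁ = 0 := hx₁ 1
  have f2 : f x₂ = 0 := hx₂ 0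
  have g2 : g x₂ = 1 := hx₂ 1
  have hsk : ∀ (θ : L →ₗ[ℝ] ℝ) (x y : L), θ ⁅x, y⁆ = -θ ⁅y, x⁆ := fun θ x y => by
    rw [← lie_skew, map_neg]
  set k := ζ ⁅x₁, x₂⁆ with hk
  have hζ1 : ∀ y : L, ζ ⁅x₁, y⁆ = k * g y := fun y => by
    have := hgζ x₂ x₁ y
    rw [g1, g2, hsk ζ x₂ x₁, ← hk] at this
    linear_combination this
  have hζ : ∀ x y : L, ζ ⁅x, y⁆ = k * (f x * g y - f y * g x) := fun x y => by
    have := hcA A₁ x₁ x y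
    rw [← hf, ← hf, ← hf, f1, hsk ζ y x₁, hζ1, hζ1] at this
    linear_combination this
  have hk0 : k ≠ 0 := fun h0 =>
    one_ne_zero (h.indep 0 1 fun x y => by rw [hζ, h0]; ring).2
  have hDk : ∀ y, f y = 0 → g y = 0 → D y = 0 := fun y fy gy => hB.2 _ fun A' => by
    have := hcA A' x₁ x₂ y
    rw [hζ x₁, hζ x₂, hζ y, fy, gy, f1, f2, g1, g2] at this
    simpa [hk0] using this
  -- `D` factors through `f` and `g`. If `D x₂ ≠ 0`, pairing with a suitable vector that cancels the
  -- `f`-part would recover `g`, contrary to `hg`.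
  have hD2 : D x₂ = 0 := hB.2 _ fun A' => by
    by_contra h0
    refine hg ⟨(B A' (D x₂))⁻¹ • (A' - B A' (D x₁) • A₁), fun x => ?_⟩
    have hx : D x = f x • D x₁ + g x • D x₂ := by
      rw [← sub_eq_zero, ← map_smul, ← map_smul, ← map_add, ← map_sub]
      exact hDk _ (by simp [f1, f2]) (by simp [g1, g2])
    rw [map_smul, map_sub, map_smul, LinearMap.smul_apply, LinearMap.sub_apply,
      LinearMap.smul_apply, ← hf, hx, map_add, map_smul, map_smul]
    simp only [smul_eq_mul]
    field_simp
    ring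
  obtain ⟨p, q, hη⟩ := exists_eq_wedge_add_wedge η f g f1 g1 f2 g2 fun x y fx gx fy gy => by
    have := hgη x₂ x y
    rw [hDk x fx gx, hDk y fy gy, hD2, gx, gy, g2] at this
    simpa using this
  refine (h.change 1 0 0 k⁻¹ (by simpa using hk0)).isListed_of_parabolic hc f p g q
    (fun x y => ?_) (fun x y => ?_)
  · simp [hη]
  · simp [hζ, hk0]

end TwoFormFactorization

/-! ### The classification for admissible algebras -/

section Admissible

variable {L : Type*} [LieRing L] [LieAlgebra ℝ L] [FiniteDimensional ℝ L]
  {A : Type*} [AddCommGroup A] [Module ℝ A] [LieRingModule L A] [LieModule ℝ L A]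
  {B : LinearMap.BilinForm ℝ A}

theorem isListed_of_two_step (hc : ∀ x y z : L, ⁅⁅x, y⁆, z⁆ = 0)
    (hd : Module.finrank ℝ (LieModule.lowerCentralSeries ℝ L L 1) = 2)
    (hBs : B.IsSymm) (hBn : B.Nondegenerate) (c : QuadCocycle L B)
    (hinv : ∀ x y : L, c.α x y ∈ LieModule.maxTrivSubmodule ℝ L A)
    (hA : ConditionA c 1) (hB : ConditionB c 1) : IsListed L := by
  have hcu : ∀ u ∈ LieModule.lowerCentralSeries ℝ L L 1, ∀ x : L, ⁅u, x⁆ = 0 := fun u hu x => by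
    have := lcs_one_induction (LieModule.toEnd ℝ L L x : L →ₗ[ℝ] L)
      (fun y z => by
        change ⁅x, ⁅y, z⁆⁆ = 0
        rw [← lie_skew, hc, neg_zero]) u hu
    rw [← lie_skew]
    exact neg_eq_zero.2 this
  have hcu' : ∀ u ∈ LieModule.lowerCentralSeries ℝ L L 1, ∀ x : L, ⁅x, u⁆ = 0 := fun u hu x => by
    rw [← lie_skew, hcu u hu, neg_zero]
  have hsk : ∀ x y, c.α x y = -c.α y x := fun x y => (twoCochain_skew _ _ _).symm
  have hcyc' : ∀ {Y Z : L} {η ζ : L →ₗ[ℝ] ℝ}, IsDerivedBasis Y Z η ζ → ∀ x y z : L,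
      (η ⁅x, y⁆ • c.α Y z + ζ ⁅x, y⁆ • c.α Z z) + (η ⁅y, z⁆ • c.α Y x + ζ ⁅y, z⁆ • c.α Z x)
      + (η ⁅z, x⁆ • c.α Y y + ζ ⁅z, x⁆ • c.α Z y) = 0 := by
    intro Y Z η ζ hb x y z
    have h0 : ∀ x y z : L, c.α ⁅x, y⁆ z = η ⁅x, y⁆ • c.α Y z + ζ ⁅x, y⁆ • c.α Z z := by
      intro x y z
      conv_lhs => rw [hb.eq_add _ (lie_mem_lcs_one x y)]
      rw [map_add, map_smul, map_smul]
      rfl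
    rw [← h0, ← h0, ← h0]
    exact c.cyclic hinv x y z
  have hαz : ∀ u ∈ LieModule.lowerCentralSeries ℝ L L 1,
      ∀ v ∈ LieModule.lowerCentralSeries ℝ L L 1, c.α u v = 0 := fun u hu v hv => by
    have := lcs_one_induction (c.α v) (fun x y => by
      have := c.cyclic hinv x y v
      rw [hcu' v hv y, hcu v hv x, map_zero, LinearMap.zero_apply, LinearMap.zero_apply, add_zero,
        add_zero] at this
      rw [hsk, this, neg_zero]) u hu
    rw [hsk, this, neg_zero]
  have hγ0 : ∀ {Y Z : L} {η ζ : L →ₗ[ℝ] ℝ}, IsDerivedBasis Y Z η ζ → ∀ x y z : L,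
      c.γ ![⁅x, y⁆, z, Z] = -η ⁅x, y⁆ * c.γ ![z, Y, Z] ∧
      c.γ ![⁅x, y⁆, z, Y] = ζ ⁅x, y⁆ * c.γ ![z, Y, Z] := by
    intro Y Z η ζ hb x y z
    rw [hb.eq_add _ (lie_mem_lcs_one x y), alternating_add_smul, alternating_add_smul,
      ← hb.eq_add _ (lie_mem_lcs_one x y), alternating_swap_right c.γ Z Z z,
      alternating_self_left, alternating_swap_right c.γ Y Y z, alternating_self_left,
      alternating_swap c.γ z Y Z, alternating_rotate c.γ Z z Y |>.symm]
    constructor <;> ring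
  -- The alternative is whether `α` kills a nonzero vector of the derived algebra. If so, that
  -- vector is taken as `Y`, and `(A_1)` must be rescued by `γ`.
  by_cases hII : ∃ Y ∈ LieModule.lowerCentralSeries ℝ L L 1, Y ≠ 0 ∧ ∀ x, c.α Y x = 0
  · obtain ⟨Y, hY, hY0, hαY⟩ := hII
    obtain ⟨Z, η, ζ, hb⟩ := exists_isDerivedBasis hd Y hY hY0
    have hYx : ∀ x : L, ⁅x, Y⁆ = 0 := hcu' Y hY
    have hZx : ∀ x : L, ⁅x, Z⁆ = 0 := hcu' Z hb.mem_right
    let g : L →ₗ[ℝ] ℝ :=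
      { toFun := fun x => c.γ ![x, Y, Z]
        map_add' := fun x y => AlternatingMap.map_vecCons_add _ _ _ _
        map_smul' := fun r x => AlternatingMap.map_vecCons_smul _ _ _ _ }
    have hg : ∀ x, g x = c.γ ![x, Y, Z] := fun x => rfl
    refine hb.isFrame.isListed_of_left_zero hc hBn (c.α Z) (fun x y z => ?_) g ?_
      (fun x y z => ?_) (fun x y => c.α x y) (fun x y z => ?_)
    · simpa [hαY] using hcyc' hb x y z
    · rintro ⟨A₀, hA₀⟩
      -- If `g` were `⟨A₀, α(Z,·)⟩`, then `Y` would satisfy the hypothesis of `(A_1)`. The choice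
      -- `Z₀ = 0` costs nothing because the derived algebra is central.
      refine hY0 (hA Y ⟨fun x => hYx x, hY⟩ ⟨A₀, 0, fun x => ⟨by rw [hsk, hαY, neg_zero], ?_⟩⟩)
      rintro ⟨y, hy⟩
      rw [LinearMap.zero_apply, add_zero, hsk x, map_neg, neg_neg]
      change c.γ ![x, Y, y] = B A₀ (c.α y x)
      have e1 : c.γ ![x, Y, y] = c.γ ![y, x, Y] := alternating_rotate c.γ y x Y
      rw [e1, hb.eq_add y hy, alternating_add_smul, map_add, map_smul, map_smul,
        LinearMap.add_apply, LinearMap.smul_apply, LinearMap.smul_apply, hαY, smul_zero, zero_add,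
        map_smul, ← hA₀, hg, alternating_swap_right c.γ Y Y x, alternating_self_left,
        alternating_rotate c.γ Z x Y |>.symm]
      simp
    · have := c.d_γ_apply hBs x y z Y
      rw [hsk z Y, hsk y Y, hsk x Y, hαY, hαY, hαY, dThree, hYx, hYx, hYx, (hγ0 hb x y z).2,
        (hγ0 hb x z y).2, (hγ0 hb y z x).2, ← hg, ← hg, ← hg, alternating_zero_left,
        alternating_zero_left, alternating_zero_left, ← lie_skew x z, map_neg] at this
      simp only [neg_zero, map_zero, LinearMap.zero_apply] at this
      linear_combination -this
    · have := c.d_γ_apply hBs x y z Z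
      rw [hsk z Z, hsk y Z, hsk x Z, dThree, hZx, hZx, hZx, (hγ0 hb x y z).1,
        (hγ0 hb x z y).1, (hγ0 hb y z x).1, ← hg, ← hg, ← hg, alternating_zero_left,
        alternating_zero_left, alternating_zero_left, ← lie_skew x z, map_neg] at this
      simp only [map_neg, LinearMap.neg_apply, hBs.eq (c.α Z x)] at this
      linear_combination this
  · obtain ⟨Y, hY, hY0⟩ : ∃ Y ∈ LieModule.lowerCentralSeries ℝ L L 1, Y ≠ 0 := by
      by_contra hcon
      push Not at hcon
      have : LieModule.lowerCentralSeries ℝ L L 1 = ⊥ := (LieSubmodule.eq_bot_iff _).2 hcon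
      rw [this] at hd
      exact absurd (finrank_bot ℝ L) (hd.trans_ne two_ne_zero)
    obtain ⟨Z, η, ζ, hb⟩ := exists_isDerivedBasis hd Y hY hY0
    by_cases hI : ∃ A₀ : A, ∀ r s : ℝ, (∀ x, r * B A₀ (c.α Y x) + s * B A₀ (c.α Z x) = 0) →
        r = 0 ∧ s = 0
    · obtain ⟨A₀, hA₀⟩ := hI
      refine hb.isFrame.isListed_of_indep_pair hc (c.α Y) (c.α Z) (hcyc' hb) (fun x y => ?_)
        (fun s hs hx hsp => ?_) A₀ hA₀
      -- The left side vanishes: `Y`, `Z` are central, and `γ` is alternating on the plane that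
      -- contains `⁅x, y⁆`, `Y`, `Z`. Since `α Y Z = 0`, the right side is the asserted symmetry.
      · have := c.d_γ_apply hBs x y Y Z
        rw [dThree, hcu' Y hY, hcu' Y hY, hcu' Z hb.mem_right, hcu' Z hb.mem_right,
          hcu' Z hb.mem_right, (hγ0 hb x y Y).1, alternating_self_left,
          alternating_zero_left, alternating_zero_left, alternating_zero_left,
          alternating_zero_left, alternating_zero_left, hαz Y hY Z hb.mem_right, hsk y Z,
          hsk x Y, hsk x Z, hsk y Y] at this
        simp only [map_neg, LinearMap.neg_apply, map_zero] at this
        linarith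
      · refine hB.eq_zero_of_isotropic s hs (fun x y hy => ?_) ?_
        · obtain ⟨⟨r, hr⟩, t, ht⟩ := hsp x
          refine ⟨-(η y * r + ζ y * t), ?_⟩
          rw [hsk, hb.eq_add y hy, map_add, map_smul, map_smul, LinearMap.add_apply,
            LinearMap.smul_apply, LinearMap.smul_apply, hr, ht, ← hb.eq_add y hy]
          module
        · obtain ⟨x, hx⟩ := hx
          refine ⟨-x, Y, hY, hcu' Y hY _, ?_⟩
          rw [map_neg, LinearMap.neg_apply, ← hsk, hx]
    · push Not at hI
      refine hb.isFrame.isListed_of_dependent_pairs hc hBn (c.α Y) (c.α Z) (hcyc' hb)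
        (fun r s hrs => ?_) fun A₀ => ?_
      · by_contra hcon
        have hmem : r • Y + s • Z ∈ LieModule.lowerCentralSeries ℝ L L 1 :=
          add_mem (SMulMemClass.smul_mem r hY) (SMulMemClass.smul_mem s hb.mem_right)
        refine hII ⟨r • Y + s • Z, hmem, fun h0 => hcon ?_, fun x => ?_⟩
        · have e1 := congrArg η h0
          have e2 := congrArg ζ h0
          simp only [map_add, map_smul, hb.fst_left, hb.fst_right, hb.snd_left, hb.snd_right,
            smul_eq_mul, map_zero] at e1 e2
          exact ⟨by linarith, by linarith⟩
        · rw [map_add, map_smul, map_smul]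
          exact hrs x
      · obtain ⟨r, s, hrs, hne⟩ := hI A₀
        exact ⟨r, s, by tauto, hrs⟩

/-- Choosing `Y` in the line `l^3` gives `⁅x, Z⁆ = f x • Y` and `α(Y,·) = f • a`. The conditions at
level 2 make `a` non-isotropic; pairing closedness of `α` with `a`, and using Jacobi, makes `f`
divide both structure forms. -/
theorem isListed_of_three_step
    (hd : Module.finrank ℝ (LieModule.lowerCentralSeries ℝ L L 1) = 2)
    (h2 : LieModule.lowerCentralSeries ℝ L L 2 ≠ ⊥)
    (h21 : LieModule.lowerCentralSeries ℝ L L 2 ≠ LieModule.lowerCentralSeries ℝ L L 1)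
    (h3 : LieModule.lowerCentralSeries ℝ L L 3 = ⊥)
    (hBs : B.IsSymm) (c : QuadCocycle L B)
    (hinv : ∀ x y : L, c.α x y ∈ LieModule.maxTrivSubmodule ℝ L A)
    (hA : ConditionA c 2) (hB : ConditionB c 2) : IsListed L := by
  have h12 : LieModule.lowerCentralSeries ℝ L L 2 ≤ LieModule.lowerCentralSeries ℝ L L 1 :=
    LieModule.antitone_lowerCentralSeries ℝ L L (by norm_num)
  obtain ⟨Y, hY2, hY0⟩ : ∃ Y ∈ LieModule.lowerCentralSeries ℝ L L 2, Y ≠ 0 := by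
    by_contra hcon
    push Not at hcon
    exact h2 ((LieSubmodule.eq_bot_iff _).2 hcon)
  have hY := h12 hY2
  obtain ⟨Z, η, ζ, hb⟩ := exists_isDerivedBasis hd Y hY hY0
  have hZ := hb.mem_right
  have hYx : ∀ x : L, ⁅x, Y⁆ = 0 := fun x => by
    have : ⁅x, Y⁆ ∈ LieModule.lowerCentralSeries ℝ L L 3 :=
      LieSubmodule.lie_mem_lie (LieSubmodule.mem_top x) hY2
    rwa [h3, LieSubmodule.mem_bot] at this
  have hζ2 : ∀ u ∈ LieModule.lowerCentralSeries ℝ L L 2, ζ u = 0 := by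
    by_contra hcon
    push Not at hcon
    obtain ⟨u, hu, hu0⟩ := hcon
    have hZ2 : Z ∈ LieModule.lowerCentralSeries ℝ L L 2 := by
      have : Z = (ζ u)⁻¹ • (u - η u • Y) := by
        conv_rhs => rw [hb.eq_add u (h12 hu)]
        simp [hb.fst_left, hb.snd_left, hb.fst_right, hb.snd_right, hu0]
      rw [this]
      exact SMulMemClass.smul_mem _ (sub_mem hu (SMulMemClass.smul_mem _ hY2))
    refine h21 (le_antisymm h12 fun v hv => ?_)
    rw [hb.eq_add v hv]
    exact add_mem (SMulMemClass.smul_mem _ hY2) (SMulMemClass.smul_mem _ hZ2)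
  have hY' : ∀ u ∈ LieModule.lowerCentralSeries ℝ L L 2, u = η u • Y := fun u hu => by
    have := hb.eq_add u (h12 hu)
    rwa [hζ2 u hu, zero_smul, add_zero] at this
  have hm2 : ∀ x : L, ∀ u ∈ LieModule.lowerCentralSeries ℝ L L 1,
      ⁅x, u⁆ ∈ LieModule.lowerCentralSeries ℝ L L 2 := fun x u hu =>
    LieSubmodule.lie_mem_lie (LieSubmodule.mem_top x) hu
  let f : L →ₗ[ℝ] ℝ := -(η ∘ₗ (LieModule.toEnd ℝ L L Z))
  have hf : ∀ x, f x = η ⁅x, Z⁆ := fun x => by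
    rw [← lie_skew, map_neg]; rfl
  have hfZ : ∀ x : L, ⁅x, Z⁆ = f x • Y := fun x => by
    rw [hf]
    exact hY' _ (hm2 x Z hZ)
  have hxu : ∀ x : L, ∀ u ∈ LieModule.lowerCentralSeries ℝ L L 1, ⁅x, u⁆ = (ζ u * f x) • Y :=
    fun x u hu => by
      conv_lhs => rw [hb.eq_add u hu]
      rw [lie_add, lie_smul, lie_smul, hYx, hfZ, smul_zero, zero_add, smul_smul]
  have hsk : ∀ x y, c.α x y = -c.α y x := fun x y => (twoCochain_skew _ _ _).symm
  have hθ : ∀ (θ : L →ₗ[ℝ] ℝ) (x y : L), θ ⁅x, y⁆ = -θ ⁅y, x⁆ := fun θ x y => by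
    rw [← lie_skew, map_neg]
  have hf0 : ∃ x, f x ≠ 0 := by
    by_contra hcon
    push Not at hcon
    refine hY0 (lcs_succ_induction 1 LinearMap.id (fun x u hu => ?_) Y hY2)
    change ⁅x, u⁆ = 0
    rw [hxu x u hu, hcon, mul_zero, zero_smul]
  obtain ⟨x₁, hx₁⟩ : ∃ x, f x = 1 := by
    obtain ⟨x, hx⟩ := hf0
    exact ⟨(f x)⁻¹ • x, by rw [map_smul, smul_eq_mul, inv_mul_cancel₀ hx]⟩
  have hfu : ∀ x y : L, f ⁅x, y⁆ = 0 := fun x y => by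
    have h1 := hxu Z _ (lie_mem_lcs_one x y)
    have h0 := hfZ Z
    rw [lie_self] at h0
    have : f Z = 0 := (smul_eq_zero.1 h0.symm).resolve_right hY0
    rw [this, mul_zero, zero_smul] at h1
    rw [hf, ← lie_skew, h1, neg_zero, map_zero]
  have hαY : ∀ u ∈ LieModule.lowerCentralSeries ℝ L L 1, c.α Y u = 0 :=
    lcs_one_induction (c.α Y) fun x y => by
      have := c.cyclic hinv x y Y
      rw [hYx, ← lie_skew Y x, hYx, neg_zero, map_zero, LinearMap.zero_apply,
        LinearMap.zero_apply, add_zero, add_zero] at this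
      rw [hsk, this, neg_zero]
  set a := c.α Y x₁ with ha
  have hαYx : ∀ x, c.α Y x = f x • a := fun x => by
    -- Since `⁅x₁, Z⁆ = Y` and `α` vanishes on the derived algebra, the identity at this triple
    -- leaves only `α Y x` and `f x • α Y x₁`.
    have := c.cyclic hinv x₁ Z x
    rw [hfZ, ← lie_skew Z x, hfZ, hb.eq_add _ (lie_mem_lcs_one x x₁)] at this
    simp only [map_neg, map_add, map_smul, LinearMap.neg_apply, LinearMap.add_apply,
      LinearMap.smul_apply, twoCochain_alt, hαY Z hZ, hx₁] at this
    rw [← sub_eq_zero, ← this, ha]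
    module
  -- If `a` were isotropic, `(B_2)` would give `a = 0`; then `α(Y,·) = 0`, and `γ(x, Y, ·)` vanishes
  -- on the line through `Y`, so `(A_2)` would give `Y = 0`.
  have haa : B a a ≠ 0 := fun h0 => by
    have ha0 : a = 0 := hB.eq_zero_of_isotropic a h0 (fun x y hy => ⟨-(η y * f x), by
      rw [hsk, hY' y hy, map_smul, LinearMap.smul_apply, hαYx, ← hY' y hy]
      module⟩) ⟨-x₁, Y, hY2, hYx _, by rw [map_neg, LinearMap.neg_apply, ← hsk]⟩
    refine hY0 (hA Y ⟨fun x => hYx x, hY2⟩ ⟨0, 0, fun x => ⟨?_, ?_⟩⟩)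
    · rw [hsk, hαYx, ha0, smul_zero, neg_zero]
    · rintro ⟨y, hy⟩
      have e1 : c.γ ![x, Y, y] = 0 := by
        rw [alternating_rotate c.γ y x Y, hY' y hy, AlternatingMap.map_vecCons_smul,
          alternating_swap_right, alternating_self_left]
        simp
      simp [e1]
  have hDa : ∀ x y, f x * B a (c.α Z y) = f y * B a (c.α Z x) := fun x y => by
    have := c.d_γ_apply hBs x Y y Z
    have e1 : c.γ ![⁅x, y⁆, Y, Z] = 0 := by
      rw [hb.eq_add _ (lie_mem_lcs_one x y), alternating_add_smul, alternating_self_left,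
        alternating_swap_right c.γ Z Z Y, alternating_self_left]
      simp
    rw [dThree, hYx, ← lie_skew Y y, hYx, hfZ x, hfZ y, ← lie_skew Y Z, hYx, neg_zero,
      alternating_zero_left, alternating_zero_left, alternating_zero_left, e1,
      AlternatingMap.map_vecCons_smul, AlternatingMap.map_vecCons_smul, alternating_self_left,
      alternating_swap_right, alternating_self_left, hαY Z hZ, hsk x Y, hαYx, hαYx,
      hsk y Z, hsk x Z] at this
    simp only [map_neg, LinearMap.neg_apply, map_smul, LinearMap.smul_apply, smul_eq_mul,
      map_zero, hBs.eq (c.α Z x) a] at this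
    linarith
  have hfζ : ∀ x y z : L, f x * ζ ⁅y, z⁆ + f y * ζ ⁅z, x⁆ + f z * ζ ⁅x, y⁆ = 0 := fun x y z => by
    have := lie_jacobi x y z
    rw [hxu x _ (lie_mem_lcs_one y z), hxu y _ (lie_mem_lcs_one z x),
      hxu z _ (lie_mem_lcs_one x y), ← add_smul, ← add_smul] at this
    linear_combination (smul_eq_zero.1 this).resolve_right hY0
  have hfη : ∀ x y z : L, f x * η ⁅y, z⁆ + f y * η ⁅z, x⁆ + f z * η ⁅x, y⁆ = 0 := fun x y z => by
    have h0 : ∀ x y z : L, B a (c.α ⁅x, y⁆ z) = η ⁅x, y⁆ * f z * B a a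
        + ζ ⁅x, y⁆ * f z * B a (c.α Z x₁) := by
      intro x y z
      have e1 := hDa x₁ z
      rw [hx₁, one_mul] at e1
      conv_lhs => rw [hb.eq_add _ (lie_mem_lcs_one x y)]
      simp only [map_add, map_smul, LinearMap.add_apply, LinearMap.smul_apply, hαYx, smul_eq_mul,
        e1]
      ring
    have := congrArg (B a) (c.cyclic hinv x y z)
    rw [map_add, map_add, h0, h0, h0, map_zero] at this
    refine (mul_eq_zero.1 (?_ : B a a * _ = 0)).resolve_left haa
    linear_combination this - B a (c.α Z x₁) * hfζ x y z
  -- `ζ` is prescribed only on the derived algebra. This extension of the same restriction is the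
  -- one for which `η ⁅x, y⁆` is exactly `f ∧ ζ'`.
  let ζ' : L →ₗ[ℝ] ℝ := η ∘ₗ (LieModule.toEnd ℝ L L x₁)
  let g : L →ₗ[ℝ] ℝ := ζ ∘ₗ (LieModule.toEnd ℝ L L x₁)
  have hζ' : ∀ x, ζ' x = η ⁅x₁, x⁆ := fun x => rfl
  have hg : ∀ x, g x = ζ ⁅x₁, x⁆ := fun x => rfl
  have hζζ' : ∀ u ∈ LieModule.lowerCentralSeries ℝ L L 1, ζ' u = ζ u := fun u hu => by
    rw [hζ', hxu x₁ u hu, map_smul, hb.fst_left, hx₁]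
    simp
  have hfr : IsFrame η ζ' := by
    refine ⟨fun r s hrs => hb.isFrame.indep r s fun x y => ?_, fun u hu e1 e2 => ?_⟩
    · rw [← hζζ' _ (lie_mem_lcs_one x y)]
      exact hrs x y
    · exact hb.isFrame.inj u hu e1 (by rw [← hζζ' u hu, e2])
  refine hfr.isListed_of_g41 f g (fun x y => ?_) (fun x y => ?_) hfu fun x y => ?_
  · have := hfη x₁ x y
    rw [hx₁, hθ η y x₁] at this
    rw [hζ', hζ']
    linear_combination this
  · have := hfζ x₁ x y
    rw [hx₁, hθ ζ y x₁] at this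
    rw [hζζ' _ (lie_mem_lcs_one x y), hg, hg]
    linear_combination this
  · rw [hg]
    exact hζ2 _ (hm2 _ _ (lie_mem_lcs_one x y))

theorem IsAdmissible.isListed [LieRing.IsNilpotent L] (h : IsAdmissible L)
    (hd : Module.finrank ℝ (LieModule.lowerCentralSeries ℝ L L 1) = 2) : IsListed L := by
  obtain ⟨A, _, _, _, _, B, hB, φ, c, -, hinv, m, hm, hAB⟩ := h
  have hlt : ∀ k, LieModule.lowerCentralSeries ℝ L L k ≠ ⊥ → k ≤ m := fun k hk => by
    by_contra hkm
    apply hk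
    rw [eq_bot_iff, ← hm]
    exact LieModule.antitone_lowerCentralSeries ℝ L L (by omega)
  have h1 : LieModule.lowerCentralSeries ℝ L L 1 ≠ ⊥ := fun h0 => by
    rw [h0] at hd
    exact absurd (finrank_bot ℝ L) (hd.trans_ne two_ne_zero)
  by_cases h2 : LieModule.lowerCentralSeries ℝ L L 2 = ⊥
  · obtain ⟨hA1, hB1⟩ := hAB 1 (hlt 1 h1)
    refine isListed_of_two_step (fun x y z => ?_) hd hB.symm hB.nondegenerate c hinv hA1 hB1
    have : ⁅z, ⁅x, y⁆⁆ ∈ LieModule.lowerCentralSeries ℝ L L 2 :=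
      LieSubmodule.lie_mem_lie (LieSubmodule.mem_top z) (lie_mem_lcs_one x y)
    rw [h2, LieSubmodule.mem_bot] at this
    rw [← lie_skew, this, neg_zero]
  · obtain ⟨hA2, hB2⟩ := hAB 2 (hlt 2 h2)
    have l1 := lcs_succ_lt h1
    have l2 := lcs_succ_lt h2
    refine isListed_of_three_step hd h2 l1.ne ?_ hB.symm c hinv hA2 hB2
    -- A nonzero fourth term would force three strict drops of dimension starting from 2.
    by_contra h3
    have l3 := lcs_succ_lt h3
    have f1 := Submodule.finrank_lt_finrank_of_lt (show
      (LieModule.lowerCentralSeries ℝ L L 2).toSubmodule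
        < (LieModule.lowerCentralSeries ℝ L L 1).toSubmodule from l1)
    have f2 := Submodule.finrank_lt_finrank_of_lt (show
      (LieModule.lowerCentralSeries ℝ L L 3).toSubmodule
        < (LieModule.lowerCentralSeries ℝ L L 2).toSubmodule from l2)
    have f3 := Submodule.finrank_lt_finrank_of_lt (show
      (LieModule.lowerCentralSeries ℝ L L 4).toSubmodule
        < (LieModule.lowerCentralSeries ℝ L L 3).toSubmodule from l3)
    change Module.finrank ℝ (LieModule.lowerCentralSeries ℝ L L 1).toSubmodule = 2 at hd
    omega

end Admissible

/-! ### A semi-simple orthogonal module on which `ℝ^k` acts faithfully for `k ≥ 1` -/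

section RotationModule

/-- The space `ℝ² ⊕ ℝ^k ⊕ ℝ^k`, on which `ℝ^k` acts trivially on the first summand and by
infinitesimal rotations of the `k` coordinate planes of `ℝ^k ⊕ ℝ^k`. -/
def RotModule (k : ℕ) : Type := (ℝ × ℝ) × (Fin k → ℝ) × (Fin k → ℝ)

variable {k : ℕ}

instance : AddCommGroup (RotModule k) :=
  inferInstanceAs (AddCommGroup ((ℝ × ℝ) × (Fin k → ℝ) × (Fin k → ℝ)))
instance : Module ℝ (RotModule k) :=
  inferInstanceAs (Module ℝ ((ℝ × ℝ) × (Fin k → ℝ) × (Fin k → ℝ)))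
instance : FiniteDimensional ℝ (RotModule k) :=
  inferInstanceAs (FiniteDimensional ℝ ((ℝ × ℝ) × (Fin k → ℝ) × (Fin k → ℝ)))

namespace RotModule

/-- The first coordinate of the summand `ℝ²`. -/
def fst (k : ℕ) : RotModule k →ₗ[ℝ] ℝ :=
  LinearMap.fst ℝ ℝ ℝ ∘ₗ LinearMap.fst ℝ (ℝ × ℝ) ((Fin k → ℝ) × (Fin k → ℝ))

/-- The second coordinate of the summand `ℝ²`. -/
def snd (k : ℕ) : RotModule k →ₗ[ℝ] ℝ :=
  LinearMap.snd ℝ ℝ ℝ ∘ₗ LinearMap.fst ℝ (ℝ × ℝ) ((Fin k → ℝ) × (Fin k → ℝ))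

/-- The first coordinate of the `i`-th rotation plane. -/
def re (i : Fin k) : RotModule k →ₗ[ℝ] ℝ :=
  (LinearMap.proj i : (Fin k → ℝ) →ₗ[ℝ] ℝ) ∘ₗ LinearMap.fst ℝ (Fin k → ℝ) (Fin k → ℝ) ∘ₗ
    LinearMap.snd ℝ (ℝ × ℝ) ((Fin k → ℝ) × (Fin k → ℝ))

/-- The second coordinate of the `i`-th rotation plane. -/
def im (i : Fin k) : RotModule k →ₗ[ℝ] ℝ :=
  (LinearMap.proj i : (Fin k → ℝ) →ₗ[ℝ] ℝ) ∘ₗ LinearMap.snd ℝ (Fin k → ℝ) (Fin k → ℝ) ∘ₗ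
    LinearMap.snd ℝ (ℝ × ℝ) ((Fin k → ℝ) × (Fin k → ℝ))

/-- The vector with given coordinates. -/
def mk (r s : ℝ) (u v : Fin k → ℝ) : RotModule k := ((r, s), u, v)

@[simp] theorem fst_mk (r s : ℝ) (u v : Fin k → ℝ) : fst k (mk r s u v) = r := rfl
@[simp] theorem snd_mk (r s : ℝ) (u v : Fin k → ℝ) : snd k (mk r s u v) = s := rfl
@[simp] theorem re_mk (r s : ℝ) (u v : Fin k → ℝ) (i : Fin k) : re i (mk r s u v) = u i := rfl
@[simp] theorem im_mk (r s : ℝ) (u v : Fin k → ℝ) (i : Fin k) : im i (mk r s u v) = v i := rfl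

theorem ext {a b : RotModule k} (h₁ : fst k a = fst k b) (h₂ : snd k a = snd k b)
    (h₃ : ∀ i, re i a = re i b) (h₄ : ∀ i, im i a = im i b) : a = b :=
  Prod.ext (Prod.ext h₁ h₂) (Prod.ext (funext h₃) (funext h₄))

/-- The infinitesimal rotation by `t`. -/
def rot (t : Fin k → ℝ) (a : RotModule k) : RotModule k :=
  mk 0 0 (fun i => -(t i * im i a)) (fun i => t i * re i a)

instance : LieRingModule (Rab k) (RotModule k) where
  bracket t a := rot t a
  add_lie s t a := by
    change rot (fun i => s i + t i) a = rot s a + rot t a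
    apply ext <;> intros <;> simp [rot] <;> ring
  lie_add t a b := by
    apply ext <;> intros <;> simp [rot] <;> ring
  leibniz_lie s t a := by
    change rot s (rot t a) = rot (fun _ => 0) a + rot t (rot s a)
    apply ext <;> intros <;> simp [rot] <;> ring

instance : LieModule ℝ (Rab k) (RotModule k) where
  smul_lie r t a := by
    change rot (fun i => r * t i) a = r • rot t a
    apply ext <;> intros <;> simp [rot] <;> ring
  lie_smul r t a := by
    change rot t (r • a) = r • rot t a
    apply ext <;> intros <;> simp [rot] <;> ring

theorem lie_def (t : Rab k) (a : RotModule k) : ⁅t, a⁆ = rot t a := rfl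

/-- The inner product `diag(1, ε)` on `ℝ²`, extended by the standard one. -/
noncomputable def form (k : ℕ) (ε : ℝ) : LinearMap.BilinForm ℝ (RotModule k) :=
  LinearMap.mk₂ ℝ
    (fun a b => fst k a * fst k b + ε * (snd k a * snd k b)
      + ∑ i, (re i a * re i b + im i a * im i b))
    (fun a a' b => by simp only [map_add, add_mul, Finset.sum_add_distrib]; ring)
    (fun r a b => by
      simp only [map_smul, smul_eq_mul, mul_assoc, ← mul_add, ← Finset.mul_sum]; ring)
    (fun a b b' => by simp only [map_add, mul_add, Finset.sum_add_distrib]; ring)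
    (fun r a b => by
      simp only [map_smul, smul_eq_mul, mul_left_comm _ r, ← mul_add, ← Finset.mul_sum])

theorem form_apply (ε : ℝ) (a b : RotModule k) :
    form k ε a b = fst k a * fst k b + ε * (snd k a * snd k b)
      + ∑ i, (re i a * re i b + im i a * im i b) := rfl

theorem form_isSymm (ε : ℝ) : (form k ε).IsSymm := by
  refine ⟨fun a b => ?_⟩
  rw [form_apply, form_apply]
  congr 1
  · ring
  · exact Finset.sum_congr rfl fun i _ => by ring

theorem form_lie (ε : ℝ) (t : Rab k) (a b : RotModule k) :
    form k ε ⁅t, a⁆ b + form k ε a ⁅t, b⁆ = 0 := by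
  simp only [form_apply, lie_def, rot, fst_mk, snd_mk, re_mk, im_mk, mul_zero, zero_mul, zero_add]
  rw [← Finset.sum_add_distrib]
  exact Finset.sum_eq_zero fun i _ => by ring

theorem eq_zero_of_form_one (a : RotModule k) (h : form k 1 a a = 0) : a = 0 := by
  rw [form_apply] at h
  have hs : ∀ i ∈ Finset.univ, 0 ≤ re i a * re i a + im i a * im i a := fun i _ =>
    add_nonneg (mul_self_nonneg _) (mul_self_nonneg _)
  have h0 := Finset.sum_nonneg hs
  have h1 := mul_self_nonneg (fst k a)
  have h2 := mul_self_nonneg (snd k a)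
  have e1 : fst k a * fst k a = 0 := by linarith
  have e2 : snd k a * snd k a = 0 := by linarith
  have e3 := (Finset.sum_eq_zero_iff_of_nonneg hs).1 (by linarith)
  refine ext (mul_self_eq_zero.1 e1) (mul_self_eq_zero.1 e2) (fun i => ?_) (fun i => ?_) <;>
  · have := e3 i (Finset.mem_univ i)
    exact mul_self_eq_zero.1 (by
      linarith [mul_self_nonneg (re i a), mul_self_nonneg (im i a)])

theorem form_one_restrict_nondegenerate (W : Submodule ℝ (RotModule k)) :
    ((form k 1).restrict W).Nondegenerate :=
  ⟨fun a ha => Subtype.ext (eq_zero_of_form_one _ (ha a)),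
    fun a ha => Subtype.ext (eq_zero_of_form_one _ (ha a))⟩

theorem form_nondegenerate {ε : ℝ} (hε : ε ≠ 0) : (form k ε).Nondegenerate := by
  have key : ∀ a : RotModule k, (∀ b, form k ε a b = 0) → a = 0 := fun a ha => by
    apply eq_zero_of_form_one
    have := ha (mk (fst k a) (ε⁻¹ * snd k a) (fun i => re i a) (fun i => im i a))
    rw [form_apply] at this ⊢
    simp only [fst_mk, snd_mk, re_mk, im_mk] at this
    rw [← this]
    field_simp
  exact ⟨key, fun a ha => key a fun b => by rw [(form_isSymm ε).eq]; exact ha b⟩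

/-- Invariance is required for the positive definite form with `ε = 1`, whatever the form of the
orthogonal module is: orthogonal complements for it are always complements. -/
theorem complementedLattice {L : Type*} [LieRing L] [LieAlgebra ℝ L]
    [LieRingModule L (RotModule k)] [LieModule ℝ L (RotModule k)]
    (h : ∀ (x : L) (a b : RotModule k), form k 1 ⁅x, a⁆ b + form k 1 a ⁅x, b⁆ = 0) :
    ComplementedLattice (LieSubmodule ℝ L (RotModule k)) := by
  refine ⟨fun N => ?_⟩
  let N' : LieSubmodule ℝ L (RotModule k) :=
    { (form k 1).orthogonal N.toSubmodule with
      lie_mem := by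
        intro x b hb a ha
        have h1 := h x a b
        have h2 : form k 1 ⁅x, a⁆ b = 0 := hb _ (N.lie_mem ha)
        change form k 1 a ⁅x, b⁆ = 0
        linarith }
  refine ⟨N', LieSubmodule.isCompl_toSubmodule.1 ?_⟩
  exact LinearMap.BilinForm.isCompl_orthogonal_of_restrict_nondegenerate
    (form_isSymm 1).isRefl (form_one_restrict_nondegenerate _)

end RotModule

end RotationModule

/-! ### Reducing admissibility to real forms -/

section Criterion

variable {L : Type*} [LieRing L] [LieAlgebra ℝ L]

open RotModule

/-- A criterion for admissibility in terms of two closed real 2-forms and a real 3-form. -/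
theorem isAdmissible_of_forms {k : ℕ} (π : L →ₗ⁅ℝ⁆ Rab k) (α₁ α₂ : twoCochain ℝ L ℝ)
    (γ : L [⋀^Fin 3]→ₗ[ℝ] ℝ) (ε : ℝ) (hε : ε ≠ 0)
    (h₁ : ∀ x y z : L, α₁ ⁅x, y⁆ z + α₁ ⁅y, z⁆ x + α₁ ⁅z, x⁆ y = 0)
    (h₂ : ∀ x y z : L, α₂ ⁅x, y⁆ z + α₂ ⁅y, z⁆ x + α₂ ⁅z, x⁆ y = 0)
    (hγ : ∀ w x y z : L, dThree γ w x y z =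
      (α₁ w x * α₁ y z - α₁ w y * α₁ x z + α₁ w z * α₁ x y)
      + ε * (α₂ w x * α₂ y z - α₂ w y * α₂ x z + α₂ w z * α₂ x y))
    (m : ℕ) (hm : LieModule.lowerCentralSeries ℝ L L (m + 1) = ⊥)
    (hA : ∀ g : L, (∀ x : L, ⁅x, g⁆ = 0) → π g = 0 → (∀ x, α₁ x g = 0) → (∀ x, α₂ x g = 0) →
      (∀ x : L, ∀ y ∈ LieModule.lowerCentralSeries ℝ L L m, ⁅x, y⁆ = 0 → α₁ x y = 0 →
        α₂ x y = 0 → γ ![x, g, y] = 0) → g = 0)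
    (hB : ε = 1 ∨
      (∃ x : L, ∃ y ∈ LieModule.lowerCentralSeries ℝ L L m, ⁅x, y⁆ = 0 ∧ α₁ x y = 1 ∧ α₂ x y = 0) ∧
      (∃ x : L, ∃ y ∈ LieModule.lowerCentralSeries ℝ L L m, ⁅x, y⁆ = 0 ∧ α₁ x y = 0 ∧ α₂ x y = 1)) :
    IsAdmissible L := by
  let _ : LieRingModule L (RotModule k) := LieRingModule.compLieHom (RotModule k) π
  have : LieModule ℝ L (RotModule k) := LieModule.compLieHom (RotModule k) π
  have hlie : ∀ (x : L) (a : RotModule k), ⁅x, a⁆ = rot (π x) a := fun x a => rfl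
  have hM : IsSemisimpleOrthogonalModule L (RotModule k) (form k ε) :=
    { finiteDimensional := inferInstance
      symm := form_isSymm ε
      nondegenerate := form_nondegenerate hε
      skew := fun x a b => form_lie ε (π x) a b
      semisimple := complementedLattice fun x a b => form_lie 1 (π x) a b }
  let ι : ℝ → ℝ → RotModule k := fun r s => mk r s 0 0
  have ιB : ∀ r s r' s', form k ε (ι r s) (ι r' s') = r * r' + ε * (s * s') := by
    intro r s r' s'
    rw [form_apply]
    simp [ι]
  have ι_add : ∀ r s r' s', ι (r + r') (s + s') = ι r s + ι r' s' := fun r s r' s' => by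
    apply ext <;> intros <;> simp [ι]
  have ι_smul : ∀ t r s, ι (t * r) (t * s) = t • ι r s := fun t r s => by
    apply ext <;> intros <;> simp [ι]
  have ι_zero : ι 0 0 = 0 := rfl
  have ι_inj : ∀ r s, ι r s = 0 → r = 0 ∧ s = 0 := fun r s h =>
    ⟨congrArg (fst k) h, congrArg (snd k) h⟩
  have ι_inv : ∀ (x : L) r s, ⁅x, ι r s⁆ = 0 := fun x r s => by
    rw [hlie]
    apply ext <;> intros <;> simp [rot, ι]
  let α : twoCochain ℝ L (RotModule k) :=
    ⟨LinearMap.mk₂ ℝ (fun x y => ι (α₁ x y) (α₂ x y))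
      (fun x x' y => by rw [map_add, map_add, LinearMap.add_apply, LinearMap.add_apply, ι_add])
      (fun r x y => by
        rw [map_smul, map_smul, LinearMap.smul_apply, LinearMap.smul_apply, smul_eq_mul,
          smul_eq_mul, ι_smul])
      (fun x y y' => by rw [map_add, map_add, ι_add])
      (fun r x y => by rw [map_smul, map_smul, smul_eq_mul, smul_eq_mul, ι_smul]),
      fun x => by rw [LinearMap.mk₂_apply, twoCochain_alt, twoCochain_alt, ι_zero]⟩
  have hα : ∀ x y, α x y = ι (α₁ x y) (α₂ x y) := fun x y => rfl
  let c : QuadCocycle L (form k ε) :=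
    { α := α
      γ := γ
      d_α := by
        ext x y z
        rw [d₂₃_apply, hα, hα, hα, hα, hα, hα, ι_inv, ι_inv, ι_inv, ← lie_skew x z, map_neg,
          map_neg, LinearMap.neg_apply, LinearMap.neg_apply]
        have e1 := h₁ x y z
        have e2 := h₂ x y z
        have e3 : ι (-α₁ ⁅z, x⁆ y) (-α₂ ⁅z, x⁆ y)
            = ι (α₁ ⁅x, y⁆ z) (α₂ ⁅x, y⁆ z) + ι (α₁ ⁅y, z⁆ x) (α₂ ⁅y, z⁆ x) := by
          rw [← ι_add]
          congr 1 <;> linarith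
        rw [e3]
        simp
      d_γ := fun w x y z => by
        rw [hγ, wedge₂₂]
        simp only [hα, ιB]
        ring }
  refine ⟨RotModule k, inferInstance, inferInstance, inferInstance, inferInstance, form k ε, hM,
    Quotient.mk _ c, c, rfl, fun x y => ?_, m, hm, fun j hj => ⟨?_, ?_⟩⟩
  · rw [LieModule.mem_maxTrivSubmodule]
    exact fun t => ι_inv t _ _
  · intro g hg ⟨A₀, Z₀, hx⟩
    -- The term of index `m` lies in all those of index `j ≤ m`, so test vectors taken from it serve
    -- every level at once.
    have hle : LieModule.lowerCentralSeries ℝ L L m ≤ LieModule.lowerCentralSeries ℝ L L j :=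
      LieModule.antitone_lowerCentralSeries ℝ L L hj
    have hcen : ∀ x : L, ⁅x, g⁆ = 0 := by
      cases j with
      | zero => exact hg.1
      | succ j => exact hg.1
    have hπ : π g = 0 := by
      cases j with
      | zero =>
        have hker : ∀ a : RotModule k, ⁅g, a⁆ = 0 := fun a =>
          (LieModule.mem_ker ℝ L (RotModule k) g).1 hg.2 a
        funext i
        -- The rotation by `π g` sends the vector with all real coordinates `1` to the one with
        -- imaginary coordinates `π g i`.
        have := congrArg (im i) (hker (mk 0 0 (fun _ => 1) 0))
        rw [hlie] at this
        have h0 : π g i = 0 := by simpa [rot] using this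
        exact h0
      | succ j =>
        -- For positive levels `g` lies in the derived algebra, which a homomorphism to an abelian
        -- algebra kills.
        refine lcs_one_induction (π : L →ₗ[ℝ] Rab k) (fun x y => π.map_lie x y) g ?_
        exact LieModule.antitone_lowerCentralSeries ℝ L L (Nat.le_add_left 1 j) hg.2
    refine hA g hcen hπ (fun x => (ι_inj _ _ (hx x).1).1) (fun x => (ι_inj _ _ (hx x).1).2)
      fun x y hy hxy e1 e2 => ?_
    -- On pairs with `⁅x, y⁆ = 0` and `α x y = 0`, the unknown `A₀` and `Z₀` disappear from the
    -- condition.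
    have := (hx x).2 ⟨y, hle hy⟩
    have e3 : ⁅x, (⟨y, hle hy⟩ : LieModule.lowerCentralSeries ℝ L L j)⁆ = 0 := Subtype.ext hxy
    change γ ![x, g, y] = -form k ε A₀ (ι (α₁ x y) (α₂ x y)) + _ at this
    rw [this, e1, e2, e3, ι_zero, map_zero, map_zero, neg_zero, add_zero]
  · rcases hB with rfl | ⟨⟨x, y, hy, hxy, e1, e2⟩, x', y', hy', hxy', e1', e2'⟩
    · exact form_one_restrict_nondegenerate _
    · have hle : LieModule.lowerCentralSeries ℝ L L m ≤ LieModule.lowerCentralSeries ℝ L L j :=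
        LieModule.antitone_lowerCentralSeries ℝ L L hj
      set W := (LinearMap.ker (bracketMap L j)).map (cochainMap c.α j)
      have hW : ∀ a ∈ W, ∃ r s, a = ι r s := by
        rintro _ ⟨t, -, rfl⟩
        induction t using TensorProduct.induction_on with
        | zero => exact ⟨0, 0, by rw [map_zero, ι_zero]⟩
        | add t t' ht ht' =>
          obtain ⟨r, s, h⟩ := ht
          obtain ⟨r', s', h'⟩ := ht'
          exact ⟨r + r', s + s', by rw [map_add, h, h', ι_add]⟩
        | tmul a b => exact ⟨α₁ a b, α₂ a b, rfl⟩
      have hW1 : ι 1 0 ∈ W := ⟨x ⊗ₜ ⟨y, hle hy⟩, hxy, by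
        change ι (α₁ x y) (α₂ x y) = _
        rw [e1, e2]⟩
      have hW2 : ι 0 1 ∈ W := ⟨x' ⊗ₜ ⟨y', hle hy'⟩, hxy', by
        change ι (α₁ x' y') (α₂ x' y') = _
        rw [e1', e2']⟩
      -- The witnesses put both basis vectors of the trivial summand `ℝ²` in `W`, so `W` is that
      -- summand, where the form is `diag(1, ε)`.
      have key : ∀ a : W, (∀ b : W, form k ε a b = 0) → a = 0 := by
        rintro ⟨a, ha⟩ hab
        obtain ⟨r, s, rfl⟩ := hW a ha
        have f1 : form k ε (ι r s) (ι 1 0) = 0 := hab ⟨_, hW1⟩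
        have f2 : form k ε (ι r s) (ι 0 1) = 0 := hab ⟨_, hW2⟩
        rw [ιB] at f1 f2
        have hr : r = 0 := by linarith
        have hs : s = 0 := (mul_eq_zero.1 (by linarith : ε * s = 0)).resolve_left hε
        exact Subtype.ext ((congrArg₂ ι hr hs).trans ι_zero)
      refine ⟨key, fun a ha => key a fun b => ?_⟩
      rw [(form_isSymm ε).eq]
      exact ha b

end Criterion

/-! ### Explicit cocycles on the five families -/

section Examples

variable {L : Type*} [LieRing L] [LieAlgebra ℝ L]

/-- The decomposable 2-cochain `f ∧ g`. -/
def wedgeCochain (f g : L →ₗ[ℝ] ℝ) : twoCochain ℝ L ℝ :=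
  ⟨LinearMap.mk₂ ℝ (fun x y => f x * g y - g x * f y)
    (fun x x' y => by simp only [map_add]; ring)
    (fun r x y => by simp only [map_smul, smul_eq_mul]; ring)
    (fun x y y' => by simp only [map_add]; ring)
    (fun r x y => by simp only [map_smul, smul_eq_mul]; ring),
    fun x => by rw [LinearMap.mk₂_apply]; ring⟩

theorem wedgeCochain_apply (f g : L →ₗ[ℝ] ℝ) (x y : L) :
    wedgeCochain f g x y = f x * g y - g x * f y := rfl

theorem zero_twoCochain_apply (x y : L) : (0 : twoCochain ℝ L ℝ) x y = 0 := rfl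

/-- The decomposable alternating 3-form `f ∧ g ∧ h`. -/
noncomputable def wedgeForm (f g h : L →ₗ[ℝ] ℝ) : L [⋀^Fin 3]→ₗ[ℝ] ℝ :=
  (Matrix.detRowAlternating (n := Fin 3) (R := ℝ)).compLinearMap (LinearMap.pi ![f, g, h])

theorem wedgeForm_apply (f g h : L →ₗ[ℝ] ℝ) (x y z : L) :
    wedgeForm f g h ![x, y, z] = f x * (g y * h z - h y * g z) - g x * (f y * h z - h y * f z)
      + h x * (f y * g z - g y * f z) := by
  refine (Matrix.det_fin_three
    (Matrix.of fun i j => (![f, g, h] : Fin 3 → L →ₗ[ℝ] ℝ) j (![x, y, z] i))).trans ?_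
  simp
  ring

theorem zero_form_apply (v : Fin 3 → L) : (0 : L [⋀^Fin 3]→ₗ[ℝ] ℝ) v = 0 := rfl

theorem lcs_two_eq_bot (h : ∀ x y z : L, ⁅x, ⁅y, z⁆⁆ = 0) :
    LieModule.lowerCentralSeries ℝ L L 2 = ⊥ :=
  (LieSubmodule.eq_bot_iff _).2 <| lcs_succ_induction 1 LinearMap.id fun x u hu =>
    lcs_one_induction (LieModule.toEnd ℝ L L x : L →ₗ[ℝ] L) (fun y z => h x y z) u hu

theorem lcs_three_eq_bot (h : ∀ w x y z : L, ⁅w, ⁅x, ⁅y, z⁆⁆⁆ = 0) :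
    LieModule.lowerCentralSeries ℝ L L 3 = ⊥ :=
  (LieSubmodule.eq_bot_iff _).2 <| lcs_succ_induction 2 LinearMap.id fun w u hu =>
    lcs_succ_induction 1 (LieModule.toEnd ℝ L L w : L →ₗ[ℝ] L) (fun x v hv =>
      lcs_one_induction ((LieModule.toEnd ℝ L L w : L →ₗ[ℝ] L) ∘ₗ
        (LieModule.toEnd ℝ L L x : L →ₗ[ℝ] L)) (fun y z => h w x y z) v hv) u hu

/-- A decomposable 2-form has square zero, so `γ = 0` is allowed; `α₁` only has to detect the line
spanned by `Y`. The same applies to `g_{5,2}` and `h(1) ⊕ h(1)`, with one decomposable form for each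
of two directions of the derived algebra. -/
theorem isAdmissible_g41 (k : ℕ) : IsAdmissible (G41 × Rab k) := by
  let c (i : Fin 4) : G41 × Rab k →ₗ[ℝ] ℝ :=
    (LinearMap.proj i : (Fin 4 → ℝ) →ₗ[ℝ] ℝ) ∘ₗ LinearMap.fst ℝ (Fin 4 → ℝ) (Rab k)
  let e (i : Fin 4) : G41 × Rab k := ((Pi.single i 1 : Fin 4 → ℝ), (0 : Rab k))
  have ce : ∀ i j, c i (e j) = if i = j then 1 else 0 := fun i j => Pi.single_apply j (1 : ℝ) i
  have hz : ∀ x : G41 × Rab k, (∀ i, c i x = 0) → x.2 = 0 → x = 0 := fun x h₁ h₂ =>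
    Prod.ext (funext h₁) h₂
  have b0 : ∀ x y : G41 × Rab k, c 0 ⁅x, y⁆ = 0 := fun x y => rfl
  have b1 : ∀ x y : G41 × Rab k, c 1 ⁅x, y⁆ = 0 := fun x y => rfl
  have b2 : ∀ x y : G41 × Rab k, c 2 ⁅x, y⁆ = c 0 x * c 3 y - c 3 x * c 0 y := fun x y => rfl
  have b3 : ∀ x y : G41 × Rab k, c 3 ⁅x, y⁆ = c 0 x * c 1 y - c 1 x * c 0 y := fun x y => rfl
  have h3 := lcs_three_eq_bot (L := G41 × Rab k) fun w x y z => by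
    refine hz _ (fun i => ?_) rfl
    fin_cases i <;> simp [-LieAlgebra.Prod.bracket_apply, b0, b1, b2, b3]
  refine isAdmissible_of_forms (LieHom.snd ℝ G41 (Rab k)) (wedgeCochain (c 0) (c 2)) 0 0 1
    one_ne_zero (fun x y z => ?_) (fun x y z => ?_) (fun w x y z => ?_) 2 h3
    (fun g hg hπ h₁ _ _ => ?_) (Or.inl rfl)
  · simp only [wedgeCochain_apply, b0, b2]; ring
  · simp only [zero_twoCochain_apply, add_zero]
  · simp only [dThree, zero_form_apply, wedgeCochain_apply, zero_twoCochain_apply]; ring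
  · have e1 := congrArg (c 2) (hg (e 0))
    have e2 := congrArg (c 3) (hg (e 0))
    have e3 := congrArg (c 3) (hg (e 1))
    have e4 := h₁ (e 0)
    simp [-LieAlgebra.Prod.bracket_apply, b2, b3, wedgeCochain_apply, ce] at e1 e2 e3 e4
    refine hz g (fun i => ?_) hπ
    fin_cases i <;> assumption

theorem isAdmissible_g52 (k : ℕ) : IsAdmissible (G52 × Rab k) := by
  let c (i : Fin 5) : G52 × Rab k →ₗ[ℝ] ℝ :=
    (LinearMap.proj i : (Fin 5 → ℝ) →ₗ[ℝ] ℝ) ∘ₗ LinearMap.fst ℝ (Fin 5 → ℝ) (Rab k)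
  let e (i : Fin 5) : G52 × Rab k := ((Pi.single i 1 : Fin 5 → ℝ), (0 : Rab k))
  have ce : ∀ i j, c i (e j) = if i = j then 1 else 0 := fun i j => Pi.single_apply j (1 : ℝ) i
  have hz : ∀ x : G52 × Rab k, (∀ i, c i x = 0) → x.2 = 0 → x = 0 := fun x h₁ h₂ =>
    Prod.ext (funext h₁) h₂
  have b0 : ∀ x y : G52 × Rab k, c 0 ⁅x, y⁆ = 0 := fun x y => rfl
  have b1 : ∀ x y : G52 × Rab k, c 1 ⁅x, y⁆ = 0 := fun x y => rfl
  have b2 : ∀ x y : G52 × Rab k, c 2 ⁅x, y⁆ = 0 := fun x y => rfl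
  have b3 : ∀ x y : G52 × Rab k, c 3 ⁅x, y⁆ = c 0 x * c 1 y - c 1 x * c 0 y := fun x y => rfl
  have b4 : ∀ x y : G52 × Rab k, c 4 ⁅x, y⁆ = c 0 x * c 2 y - c 2 x * c 0 y := fun x y => rfl
  have h2 := lcs_two_eq_bot (L := G52 × Rab k) fun x y z => by
    refine hz _ (fun i => ?_) rfl
    fin_cases i <;> simp [-LieAlgebra.Prod.bracket_apply, b0, b1, b2, b3, b4]
  refine isAdmissible_of_forms (LieHom.snd ℝ G52 (Rab k)) (wedgeCochain (c 0) (c 3))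
    (wedgeCochain (c 0) (c 4)) 0 1 one_ne_zero (fun x y z => ?_) (fun x y z => ?_)
    (fun w x y z => ?_) 1 h2 (fun g hg hπ h₁ h₂ _ => ?_) (Or.inl rfl)
  · simp only [wedgeCochain_apply, b0, b3]; ring
  · simp only [wedgeCochain_apply, b0, b4]; ring
  · simp only [dThree, zero_form_apply, wedgeCochain_apply]; ring
  · have e1 := congrArg (c 3) (hg (e 0))
    have e2 := congrArg (c 4) (hg (e 0))
    have e3 := congrArg (c 3) (hg (e 1))
    have e4 := h₁ (e 0)
    have e5 := h₂ (e 0)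
    simp [-LieAlgebra.Prod.bracket_apply, b3, b4, wedgeCochain_apply, ce] at e1 e2 e3 e4 e5
    refine hz g (fun i => ?_) hπ
    fin_cases i <;> assumption

/-- Here `α₁` detects `Z` but not `Y`, and its square is nonzero. The form `γ = c 2 ∧ c 4 ∧ c 5`
satisfies `dγ = ½ α₁ ∧ α₁` and detects `Y` at the pair `X₃`, `Z`, which commutes and is killed by
`α₁`. -/
theorem isAdmissible_g64 (k : ℕ) : IsAdmissible (G64 × Rab k) := by
  let c (i : Fin 6) : G64 × Rab k →ₗ[ℝ] ℝ :=
    (LinearMap.proj i : (Fin 6 → ℝ) →ₗ[ℝ] ℝ) ∘ₗ LinearMap.fst ℝ (Fin 6 → ℝ) (Rab k)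
  let e (i : Fin 6) : G64 × Rab k := ((Pi.single i 1 : Fin 6 → ℝ), (0 : Rab k))
  have ce : ∀ i j, c i (e j) = if i = j then 1 else 0 := fun i j => Pi.single_apply j (1 : ℝ) i
  have hz : ∀ x : G64 × Rab k, (∀ i, c i x = 0) → x.2 = 0 → x = 0 := fun x h₁ h₂ =>
    Prod.ext (funext h₁) h₂
  have b0 : ∀ x y : G64 × Rab k, c 0 ⁅x, y⁆ = 0 := fun x y => rfl
  have b1 : ∀ x y : G64 × Rab k, c 1 ⁅x, y⁆ = 0 := fun x y => rfl
  have b2 : ∀ x y : G64 × Rab k, c 2 ⁅x, y⁆ = 0 := fun x y => rfl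
  have b3 : ∀ x y : G64 × Rab k, c 3 ⁅x, y⁆ = 0 := fun x y => rfl
  have b4 : ∀ x y : G64 × Rab k, c 4 ⁅x, y⁆ =
      (c 0 x * c 1 y - c 1 x * c 0 y) + (c 2 x * c 3 y - c 3 x * c 2 y) :=
    fun x y => rfl
  have b5 : ∀ x y : G64 × Rab k, c 5 ⁅x, y⁆ = c 0 x * c 2 y - c 2 x * c 0 y := fun x y => rfl
  have h2 := lcs_two_eq_bot (L := G64 × Rab k) fun x y z => by
    refine hz _ (fun i => ?_) rfl
    fin_cases i <;> simp [-LieAlgebra.Prod.bracket_apply, b0, b1, b2, b3, b4, b5]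
  have m5 : e 5 ∈ LieModule.lowerCentralSeries ℝ (G64 × Rab k) (G64 × Rab k) 1 := by
    have : e 5 = ⁅e 0, e 2⁆ := by
      rw [← sub_eq_zero]
      refine hz _ (fun i => ?_) (sub_self 0)
      rw [map_sub]
      fin_cases i <;> simp [-LieAlgebra.Prod.bracket_apply, b0, b1, b2, b3, b4, b5, ce]
    rw [this]
    exact lie_mem_lcs_one _ _
  refine isAdmissible_of_forms (LieHom.snd ℝ G64 (Rab k))
    (wedgeCochain (c 0) (c 5) + wedgeCochain (c 1) (c 2)) 0 (wedgeForm (c 2) (c 4) (c 5)) 1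
    one_ne_zero (fun x y z => ?_) (fun x y z => ?_)
    (fun w x y z => ?_) 1 h2 (fun g hg hπ h₁ _ h₃ => ?_) (Or.inl rfl)
  · simp only [add_apply_apply, wedgeCochain_apply, b0, b1, b2, b5]; ring
  · simp only [zero_twoCochain_apply, add_zero]
  · simp only [dThree, wedgeForm_apply, add_apply_apply, wedgeCochain_apply,
      zero_twoCochain_apply, b2, b4, b5]
    ring
  · have e1 := congrArg (c 4) (hg (e 0))
    have e2 := congrArg (c 5) (hg (e 0))
    have e3 := congrArg (c 4) (hg (e 2))
    have e4 := congrArg (c 5) (hg (e 2))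
    have e5 := h₁ (e 0)
    simp [-LieAlgebra.Prod.bracket_apply, b4, b5, wedgeCochain_apply, ce] at e1 e2 e3 e4 e5
    have e6 := h₃ (e 2) (e 5) m5
      (by
        refine hz _ (fun i => ?_) rfl
        fin_cases i <;> simp [-LieAlgebra.Prod.bracket_apply, b0, b1, b2, b3, b4, b5, ce])
      (by simp [-LieAlgebra.Prod.bracket_apply, wedgeCochain_apply, ce]) rfl
    simp [-LieAlgebra.Prod.bracket_apply, wedgeForm_apply, ce] at e6
    refine hz g (fun i => ?_) hπ
    fin_cases i <;> assumption

/-- The two 2-forms have equal squares, which cancel for `ε = -1`, so `γ = 0` is allowed. The form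
is then indefinite, and `(B_k)` needs the witnesses `(X₁, Y)` and `(-X₁, Z)`, whose values under `α`
are the two basis vectors. -/
theorem isAdmissible_g65 (k : ℕ) : IsAdmissible (G65 × Rab k) := by
  let c (i : Fin 6) : G65 × Rab k →ₗ[ℝ] ℝ :=
    (LinearMap.proj i : (Fin 6 → ℝ) →ₗ[ℝ] ℝ) ∘ₗ LinearMap.fst ℝ (Fin 6 → ℝ) (Rab k)
  let e (i : Fin 6) : G65 × Rab k := ((Pi.single i 1 : Fin 6 → ℝ), (0 : Rab k))
  have ce : ∀ i j, c i (e j) = if i = j then 1 else 0 := fun i j => Pi.single_apply j (1 : ℝ) i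
  have hz : ∀ x : G65 × Rab k, (∀ i, c i x = 0) → x.2 = 0 → x = 0 := fun x h₁ h₂ =>
    Prod.ext (funext h₁) h₂
  have b0 : ∀ x y : G65 × Rab k, c 0 ⁅x, y⁆ = 0 := fun x y => rfl
  have b1 : ∀ x y : G65 × Rab k, c 1 ⁅x, y⁆ = 0 := fun x y => rfl
  have b2 : ∀ x y : G65 × Rab k, c 2 ⁅x, y⁆ = 0 := fun x y => rfl
  have b3 : ∀ x y : G65 × Rab k, c 3 ⁅x, y⁆ = 0 := fun x y => rfl
  have b4 : ∀ x y : G65 × Rab k, c 4 ⁅x, y⁆ =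
      (c 0 x * c 1 y - c 1 x * c 0 y) - (c 2 x * c 3 y - c 3 x * c 2 y) :=
    fun x y => rfl
  have b5 : ∀ x y : G65 × Rab k, c 5 ⁅x, y⁆ =
      (c 0 x * c 2 y - c 2 x * c 0 y) + (c 1 x * c 3 y - c 3 x * c 1 y) :=
    fun x y => rfl
  have h2 := lcs_two_eq_bot (L := G65 × Rab k) fun x y z => by
    refine hz _ (fun i => ?_) rfl
    fin_cases i <;> simp [-LieAlgebra.Prod.bracket_apply, b0, b1, b2, b3, b4, b5]
  have m4 : e 4 ∈ LieModule.lowerCentralSeries ℝ (G65 × Rab k) (G65 × Rab k) 1 := by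
    have : e 4 = ⁅e 0, e 1⁆ := by
      rw [← sub_eq_zero]
      refine hz _ (fun i => ?_) (sub_self 0)
      rw [map_sub]
      fin_cases i <;> simp [-LieAlgebra.Prod.bracket_apply, b0, b1, b2, b3, b4, b5, ce]
    rw [this]
    exact lie_mem_lcs_one _ _
  have m5 : e 5 ∈ LieModule.lowerCentralSeries ℝ (G65 × Rab k) (G65 × Rab k) 1 := by
    have : e 5 = ⁅e 0, e 2⁆ := by
      rw [← sub_eq_zero]
      refine hz _ (fun i => ?_) (sub_self 0)
      rw [map_sub]
      fin_cases i <;> simp [-LieAlgebra.Prod.bracket_apply, b0, b1, b2, b3, b4, b5, ce]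
    rw [this]
    exact lie_mem_lcs_one _ _
  refine isAdmissible_of_forms (LieHom.snd ℝ G65 (Rab k))
    (wedgeCochain (c 0) (c 4) + wedgeCochain (c 3) (c 5))
    (wedgeCochain (c 3) (c 4) + wedgeCochain (-c 0) (c 5)) 0 (-1)
    (by norm_num) (fun x y z => ?_) (fun x y z => ?_)
    (fun w x y z => ?_) 1 h2 (fun g hg hπ h₁ h₂ _ => ?_)
    (Or.inr ⟨⟨e 0, e 4, m4, ?_, ?_, ?_⟩, -e 0, e 5, m5, ?_, ?_, ?_⟩)
  · simp only [add_apply_apply, wedgeCochain_apply, b0, b3, b4, b5]; ring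
  · simp only [add_apply_apply, wedgeCochain_apply, LinearMap.neg_apply, b0, b3, b4, b5]; ring
  · simp only [dThree, zero_form_apply, add_apply_apply, wedgeCochain_apply,
      LinearMap.neg_apply]
    ring
  · have e1 := congrArg (c 4) (hg (e 0))
    have e2 := congrArg (c 5) (hg (e 0))
    have e3 := congrArg (c 4) (hg (e 2))
    have e4 := congrArg (c 5) (hg (e 2))
    have e5 := h₁ (e 0)
    have e6 := h₂ (e 0)
    simp [-LieAlgebra.Prod.bracket_apply, b4, b5, wedgeCochain_apply, ce] at e1 e2 e3 e4 e5 e6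
    refine hz g (fun i => ?_) hπ
    fin_cases i <;> assumption
  · refine hz _ (fun i => ?_) rfl
    fin_cases i <;> simp [-LieAlgebra.Prod.bracket_apply, b0, b1, b2, b3, b4, b5, ce]
  · simp [-LieAlgebra.Prod.bracket_apply, wedgeCochain_apply, ce]
  · simp [-LieAlgebra.Prod.bracket_apply, wedgeCochain_apply, ce]
  · refine hz _ (fun i => ?_) rfl
    fin_cases i <;> simp [-LieAlgebra.Prod.bracket_apply, b0, b1, b2, b3, b4, b5, ce]
  · simp [-LieAlgebra.Prod.bracket_apply, wedgeCochain_apply, ce]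
  · simp [-LieAlgebra.Prod.bracket_apply, wedgeCochain_apply, ce]

theorem isAdmissible_h1_h1 (k : ℕ) : IsAdmissible ((H1 × H1) × Rab k) := by
  let c (i : Fin 3) : (H1 × H1) × Rab k →ₗ[ℝ] ℝ :=
    (LinearMap.proj i : (Fin 3 → ℝ) →ₗ[ℝ] ℝ) ∘ₗ LinearMap.fst ℝ (Fin 3 → ℝ) (Fin 3 → ℝ) ∘ₗ
      LinearMap.fst ℝ ((Fin 3 → ℝ) × (Fin 3 → ℝ)) (Rab k)
  let d (i : Fin 3) : (H1 × H1) × Rab k →ₗ[ℝ] ℝ :=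
    (LinearMap.proj i : (Fin 3 → ℝ) →ₗ[ℝ] ℝ) ∘ₗ LinearMap.snd ℝ (Fin 3 → ℝ) (Fin 3 → ℝ) ∘ₗ
      LinearMap.fst ℝ ((Fin 3 → ℝ) × (Fin 3 → ℝ)) (Rab k)
  let e (i : Fin 3) : (H1 × H1) × Rab k :=
    (((Pi.single i 1 : Fin 3 → ℝ), (0 : Fin 3 → ℝ)), (0 : Rab k))
  let f (i : Fin 3) : (H1 × H1) × Rab k :=
    (((0 : Fin 3 → ℝ), (Pi.single i 1 : Fin 3 → ℝ)), (0 : Rab k))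
  have ce : ∀ i j, c i (e j) = if i = j then 1 else 0 := fun i j => Pi.single_apply j (1 : ℝ) i
  have df : ∀ i j, d i (f j) = if i = j then 1 else 0 := fun i j => Pi.single_apply j (1 : ℝ) i
  have hz : ∀ x : (H1 × H1) × Rab k, (∀ i, c i x = 0) → (∀ i, d i x = 0) → x.2 = 0 → x = 0 :=
    fun x h₁ h₂ h₃ => Prod.ext (Prod.ext (funext h₁) (funext h₂)) h₃
  have bc0 : ∀ x y : (H1 × H1) × Rab k, c 0 ⁅x, y⁆ = 0 := fun x y => rfl
  have bc1 : ∀ x y : (H1 × H1) × Rab k, c 1 ⁅x, y⁆ = 0 := fun x y => rfl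
  have bc2 : ∀ x y : (H1 × H1) × Rab k, c 2 ⁅x, y⁆ = c 0 x * c 1 y - c 1 x * c 0 y := fun x y => rfl
  have bd0 : ∀ x y : (H1 × H1) × Rab k, d 0 ⁅x, y⁆ = 0 := fun x y => rfl
  have bd1 : ∀ x y : (H1 × H1) × Rab k, d 1 ⁅x, y⁆ = 0 := fun x y => rfl
  have bd2 : ∀ x y : (H1 × H1) × Rab k, d 2 ⁅x, y⁆ = d 0 x * d 1 y - d 1 x * d 0 y := fun x y => rfl
  have h2 := lcs_two_eq_bot (L := (H1 × H1) × Rab k) fun x y z => by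
    refine hz _ (fun i => ?_) (fun i => ?_) rfl
    · fin_cases i <;> simp [-LieAlgebra.Prod.bracket_apply, bc0, bc1, bc2]
    · fin_cases i <;> simp [-LieAlgebra.Prod.bracket_apply, bd0, bd1, bd2]
  refine isAdmissible_of_forms (LieHom.snd ℝ (H1 × H1) (Rab k)) (wedgeCochain (c 0) (c 2))
    (wedgeCochain (d 0) (d 2)) 0 1 one_ne_zero (fun x y z => ?_) (fun x y z => ?_)
    (fun w x y z => ?_) 1 h2 (fun g hg hπ h₁ h₂ _ => ?_) (Or.inl rfl)
  · simp only [wedgeCochain_apply, bc0, bc2]; ring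
  · simp only [wedgeCochain_apply, bd0, bd2]; ring
  · simp only [dThree, zero_form_apply, wedgeCochain_apply]; ring
  · have e1 := congrArg (c 2) (hg (e 0))
    have e2 := congrArg (c 2) (hg (e 1))
    have e3 := h₁ (e 0)
    have e4 := congrArg (d 2) (hg (f 0))
    have e5 := congrArg (d 2) (hg (f 1))
    have e6 := h₂ (f 0)
    simp [-LieAlgebra.Prod.bracket_apply, bc2, bd2, wedgeCochain_apply, ce, df] at e1 e2 e3 e4 e5 e6
    refine hz g (fun i => ?_) (fun i => ?_) hπ
    · fin_cases i <;> assumption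
    · fin_cases i <;> assumption

end Examples

end QuadLie

theorem proposition2 :
    (∀ (L : Type*) [LieRing L] [LieAlgebra ℝ L] [FiniteDimensional ℝ L] [LieRing.IsNilpotent L],
      QuadLie.IsAdmissible L →
      Module.finrank ℝ (LieModule.lowerCentralSeries ℝ L L 1) = 2 →
      ∃ k : ℕ,
        Nonempty (L ≃ₗ⁅ℝ⁆ (QuadLie.H1 × QuadLie.H1) × QuadLie.Rab k) ∨
        Nonempty (L ≃ₗ⁅ℝ⁆ QuadLie.G41 × QuadLie.Rab k) ∨
        Nonempty (L ≃ₗ⁅ℝ⁆ QuadLie.G52 × QuadLie.Rab k) ∨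
        Nonempty (L ≃ₗ⁅ℝ⁆ QuadLie.G64 × QuadLie.Rab k) ∨
        Nonempty (L ≃ₗ⁅ℝ⁆ QuadLie.G65 × QuadLie.Rab k)) ∧
    (∀ k : ℕ,
      QuadLie.IsAdmissible ((QuadLie.H1 × QuadLie.H1) × QuadLie.Rab k) ∧
      QuadLie.IsAdmissible (QuadLie.G41 × QuadLie.Rab k) ∧
      QuadLie.IsAdmissible (QuadLie.G52 × QuadLie.Rab k) ∧
      QuadLie.IsAdmissible (QuadLie.G64 × QuadLie.Rab k) ∧
      QuadLie.IsAdmissible (QuadLie.G65 × QuadLie.Rab k)) := by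
  refine ⟨fun L _ _ _ _ h hd => h.isListed hd, fun k => ⟨?_, ?_, ?_, ?_, ?_⟩⟩
  · exact QuadLie.isAdmissible_h1_h1 k
  · exact QuadLie.isAdmissible_g41 k
  · exact QuadLie.isAdmissible_g52 k
  · exact QuadLie.isAdmissible_g64 k
  · exact QuadLie.isAdmissible_g65 k
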